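/- **Setting.** Fix countably infinite sets of relation names, of attribute names and of domain values $D$. A *schema* $\mathcal S$ is a finite partial map from relation names to finite sets of attributes. An *instance* $I$ of $\mathcal S$ assigns to each relation $R$ of $\mathcal S$ a set $R^I$ of tuples, i.e. of functions $\mathcal S(R)\to D$. An atom $R(A_1:x_1,\dots,A_k:x_k)$ is *compatible* with $\mathcal S$ if $R$ is in $\mathcal S$ and $\{A_1,\dots,A_k\}\subseteq \mathcal S(R)$; under an assignment $\tau$ it is true in $I$ if some $t\in R^I$ has $t(A_i)=\tau(x_i)$ for all $i$. A *tgd* is $\forall \bar x\,(\exists\bar y\,\varphi(\bar x,\bar y)\to\exists\bar z\,\psi(\bar x,\bar z))$ with $\varphi,\psi$ conjunctions of atoms. It is *acyclic* if no relation occurs in both $\varphi$ and $\psi$. A set of tgds is acyclic if the graph on relation names with an edge $R\to R'$ whenever some tgd of the set has $R$ on its left-hand side and $R'$ on its right-hand side is acyclic. A *procedure* $P=(\mathit{Scope},\mathcal C_{\rm in},\mathcal C_{\rm out},\mathcal Q_{\rm pres})$ consists of a finite set of structure constraints $R[\bar s]$ or $R[*]$, finite sets of pre- and postconditions, and a finite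 set of queries. An instance $I'$ of $\mathcal S$ is a *possible outcome* of applying $P$ to an instance $I$ of $\mathcal S$ if: the queries in $\mathcal Q_{\rm pres}$ are compatible with $\mathcal S$ and $I\models\mathcal C_{\rm in}$; $I'\models\mathcal C_{\rm out}$; $Q(I)=Q(I')$ for the conjunctive query $Q=Q_{\mathcal S\setminus \mathit{Scope}}$ that is the conjunction, with pairwise distinct answer variables, of one atom for each relation $R$ of $\mathcal S$ with $R[*]\notin \mathit{Scope}$, on the attributes of $R$ not mentioned in any $R[\bar s]\in \mathit{Scope}$; and $Q(I)\subseteq Q(I')$ for all $Q\in\mathcal Q_{\rm pres}$. For a sequence of procedures, $\mathit{outcomes}_{P_1,\dots,P_n}(I)$ is obtained by collecting the possible outcomes of $P_1$ on $I$, then those of $P_2$ on each of these, and so on. The procedure $P$ has *safe scope* if $\mathcal C_{\rm in}=\emptyset$; $\mathcal C_{\rm out}$ is an acyclic set of tgds; $\mathit{Scope}$ consists of exactly the constraints $R[*]$ with $R$ on the right-hand side of a tgd in $\mathcal C_{\rm out}$; and $\mathcal Q_{\rm pres}$ consists of exactly the total queries $R$ (returning all of $R^I$) with $R[*]\in \mathit{Scope}$.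 *Constraint readiness* is the problem: given a finite instance $I$ of a schema $\mathcal S$, a finite set $\Pi$ of procedures and a finite set $\Sigma$ of tgds and equality-generating dependencies, is there a finite sequence $P_1,\dots,P_n$ of procedures in $\Pi$ such that every instance in $\mathit{outcomes}_{P_1,\dots,P_n}(I)$ satisfies $\Sigma$? **Proposition.** Constraint readiness is undecidable, even if all procedures in $\Pi$ have safe scope and $\Sigma$ consists of a single acyclic tgd. More precisely, there is no computable function that answers correctly every input $(\mathcal S,I,\Pi,\Sigma)$ in which all procedures in $\Pi$ have safe scope and $\Sigma=\{t\}$ for an acyclic tgd $t$; this remains so when only inputs are considered in which all relations and attributes mentioned by $\Pi$ and $t$ belong to $\mathcal S$ and $I\not\models t$. -/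

import Mathlib

namespace DataReadiness

/-! Relation names, attribute names, domain values and variables: countably infinite sets,
each represented by the natural numbers (attribute names with their usual order). -/

abbrev RelName : Type := ℕ
abbrev Attr : Type := ℕ
abbrev Val : Type := ℕ
abbrev Var : Type := ℕ

/-! ### Schemas and instances -/

/-- A relational schema: a partial function with finite domain from relation names to finite
sets of attributes, given by its graph (see `Schema.attrs`). -/
abbrev Schema : Type := List (RelName × List Attr)

/-- The value `S(R)`; it is `none` if `R` is not in the schema. -/
def Schema.attrs (S : Schema) (R : RelName) : Option (Finset Attr) :=
  (List.lookup R S).map List.toFinset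

/-- The relation names of the schema, without repetition. -/
def Schema.rels (S : Schema) : List RelName := (S.map Prod.fst).dedup

/-- The attributes of `R`, listed in the attribute order (the empty list if `R` is not in `S`). -/
def Schema.sortedAttrs (S : Schema) (R : RelName) : List Attr :=
  ((S.attrs R).getD ∅).sort (· ≤ ·)

/-- A (named) tuple: a finite partial function from attributes to values. -/
abbrev Tuple : Type := Attr → Option Val

/-- `t` is a tuple for `R` over `S`: `R` is in `S`, and `t` is defined exactly on `S(R)`. -/
def Schema.IsTuple (S : Schema) (R : RelName) (t : Tuple) : Prop :=
  ∃ X, S.attrs R = some X ∧ ∀ A, (t A).isSome ↔ A ∈ X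

/-- An instance of schema `S`: a set of tuples over `S(R)` for each relation `R` in `S`
(and no tuple for any other relation name). -/
structure Instance (S : Schema) where
  rel : RelName → Set Tuple
  isTuple : ∀ R, ∀ t ∈ rel R, S.IsTuple R t

/-! ### Atoms, conjunctive queries, total queries -/

/-- The named atom `R(A₁:x₁,…,A_k:x_k)`. -/
structure Atom where
  rel : RelName
  args : List (Attr × Var)

/-- The variables mentioned by an atom. -/
def Atom.vars (a : Atom) : List Var := a.args.map Prod.snd

def Atom.Compatible (S : Schema) (a : Atom) : Prop :=
  ∃ X, S.attrs a.rel = some X ∧ ∀ p ∈ a.args, p.1 ∈ X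

def Atom.Sat {S : Schema} (I : Instance S) (τ : Var → Val) (a : Atom) : Prop :=
  ∃ t ∈ I.rel a.rel, ∀ p ∈ a.args, t p.1 = some (τ p.2)

/-- `(I, τ)` satisfies a conjunction of atoms. -/
def SatAll {S : Schema} (I : Instance S) (τ : Var → Val) (φ : List Atom) : Prop :=
  ∀ a ∈ φ, a.Sat I τ

/-- A conjunctive query `∃ z̄ φ(z̄,ȳ)`: `free` is the tuple `ȳ` of answer variables, `atoms` is `φ`,
and all other variables of `φ` are existentially quantified. -/
structure CQ where
  free : List Var
  atoms : List Atom

def CQ.Compatible (S : Schema) (Q : CQ) : Prop := ∀ a ∈ Q.atoms, a.Compatible S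

/-- The result `Q(I)`. -/
def CQ.answers {S : Schema} (Q : CQ) (I : Instance S) : Set (List Val) :=
  {v | ∃ τ : Var → Val, SatAll I τ Q.atoms ∧ v = Q.free.map τ}

/-- Queries: conjunctive queries, and total queries `R` (`SELECT * FROM R`). -/
inductive Query where
  | cq (Q : CQ)
  | total (R : RelName)

def Query.Compatible (S : Schema) : Query → Prop
  | .cq Q => Q.Compatible S
  | .total R => (S.attrs R).isSome

/-- The result of a query.  A total query `R` returns all tuples stored in `R`, each written as
the list of its values in the attribute order. -/
def Query.answers {S : Schema} (I : Instance S) : Query → Set (List Val)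
  | .cq Q => Q.answers I
  | .total R => {v | ∃ t ∈ I.rel R, (S.sortedAttrs R).map t = v.map some}

/-! ### Constraints -/

/-- A tuple-generating dependency `∀ x̄ (∃ ȳ φ(x̄,ȳ) → ∃ z̄ ψ(x̄,z̄))` with `φ` the conjunction `lhs`
and `ψ` the conjunction `rhs`: `x̄` are the shared variables, `ȳ` the variables that occur only
in `lhs`, and `z̄` those that occur only in `rhs`. -/
structure Tgd where
  lhs : List Atom
  rhs : List Atom

/-- An equality-generating dependency `∀ x̄ (∃ ȳ φ(x̄,ȳ) → x = x')`. -/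
structure Egd where
  lhs : List Atom
  x : Var
  x' : Var

/-- The relation `R` is mentioned in the conjunction `φ`. -/
def Mentions (φ : List Atom) (R : RelName) : Prop := ∃ a ∈ φ, a.rel = R

/-- Every assignment satisfying the left-hand side, restricted to the variables of the left-hand
side, extends to an assignment satisfying the right-hand side. -/
def Tgd.Holds {S : Schema} (I : Instance S) (d : Tgd) : Prop :=
  ∀ τ : Var → Val, SatAll I τ d.lhs →
    ∃ τ' : Var → Val, (∀ a ∈ d.lhs, ∀ x ∈ a.vars, τ' x = τ x) ∧ SatAll I τ' d.rhs

def Egd.Holds {S : Schema} (I : Instance S) (d : Egd) : Prop :=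
  ∀ τ : Var → Val, SatAll I τ d.lhs → τ d.x = τ d.x'

/-- A tgd is acyclic if no relation on the right-hand side appears on the left-hand side. -/
def Tgd.Acyclic (d : Tgd) : Prop := ∀ R, Mentions d.rhs R → ¬ Mentions d.lhs R

/-- A data constraint: a tgd or an egd. -/
inductive Dependency where
  | tgd (d : Tgd)
  | egd (d : Egd)

/-- All conjunctive queries of the dependency are compatible with the schema. -/
def Dependency.Compatible (S : Schema) : Dependency → Prop
  | .tgd d => (∀ a ∈ d.lhs, a.Compatible S) ∧ (∀ a ∈ d.rhs, a.Compatible S)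
  | .egd d => ∀ a ∈ d.lhs, a.Compatible S

/-- `I` satisfies the dependency (which includes compatibility with the schema of `I`). -/
def Dependency.Holds {S : Schema} (I : Instance S) (c : Dependency) : Prop :=
  c.Compatible S ∧
    match c with
    | .tgd d => d.Holds I
    | .egd d => d.Holds I

/-- Structure constraints: `cols R s` is `R[s]`, and `star R` is `R[*]`. -/
inductive StructConstraint where
  | cols (R : RelName) (s : List Attr)
  | star (R : RelName)
  deriving DecidableEq

def StructConstraint.Holds (S : Schema) : StructConstraint → Prop
  | .cols R s => ∃ X, S.attrs R = some X ∧ ∀ A ∈ s, A ∈ X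
  | .star R => (S.attrs R).isSome

/-- The constraints used as pre- and postconditions: tgds, egds and structure constraints. -/
inductive Constraint where
  | dep (c : Dependency)
  | struct (c : StructConstraint)

def Constraint.Holds {S : Schema} (I : Instance S) : Constraint → Prop
  | .dep c => c.Holds I
  | .struct c => c.Holds S

/-- A set `Σ` of tgds is acyclic if the graph on relation names with an edge from `R` to `R'`
whenever some tgd of `Σ` mentions `R` on the left and `R'` on the right is acyclic. -/
def AcyclicSet (D : Set Tgd) : Prop :=
  ∀ R, ¬ Relation.TransGen (fun R R' => ∃ d ∈ D, Mentions d.lhs R ∧ Mentions d.rhs R') R R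

/-! ### The query `Q_{S∖C}` -/

/-- The constraint is of the form `R[s]` with `A` in `s`. -/
def StructConstraint.mentionsAttr (c : StructConstraint) (R : RelName) (A : Attr) : Bool :=
  match c with
  | .cols R' s => R' == R && s.contains A
  | .star _ => false

/-- The atom of `Q_{S∖C}` for `R`: it retrieves the attributes of `R` not mentioned in any
constraint `R[s]` of `C`.  The variable for attribute `A` of `R` is `Nat.pair R A`, so that all
variables of `Q_{S∖C}` are different. -/
def outsideAtom (S : Schema) (C : List StructConstraint) (R : RelName) : Atom where
  rel := R
  args := ((S.sortedAttrs R).filter fun A => !(C.any fun c => c.mentionsAttr R A)).map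
    fun A => (A, Nat.pair R A)

/-- The conjunctive query `Q_{S∖C}`: the conjunction of the above atoms over all relations `R` of
`S` with `R[*]` not in `C`; all its variables are answer variables. -/
def outsideQuery (S : Schema) (C : List StructConstraint) : CQ where
  free := ((S.rels.filter fun R => StructConstraint.star R ∉ C).map (outsideAtom S C)).flatMap
    Atom.vars
  atoms := (S.rels.filter fun R => StructConstraint.star R ∉ C).map (outsideAtom S C)

/-! ### Procedures.  Lists stand for finite sets. -/

structure Procedure where
  scope : List StructConstraint
  pre : List Constraint
  post : List Constraint
  pres : List Query

def Procedure.Applicable (P : Procedure) {S : Schema} (I : Instance S) : Prop :=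
  (∀ Q ∈ P.pres, Q.Compatible S) ∧ ∀ c ∈ P.pre, c.Holds I

/-- The set of possible outcomes of applying `P` to `I`. -/
def Procedure.outcomes (P : Procedure) {S : Schema} (I : Instance S) : Set (Instance S) :=
  {I' | P.Applicable I ∧ (∀ c ∈ P.post, c.Holds I') ∧
    (outsideQuery S P.scope).answers I = (outsideQuery S P.scope).answers I' ∧
    ∀ Q ∈ P.pres, Q.answers I ⊆ Q.answers I'}

/-- The outcomes of applying a sequence of procedures, the head of the list first. -/
def seqOutcomes {S : Schema} : List Procedure → Instance S → Set (Instance S)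
  | [], I => {I}
  | P :: Ps, I => {K | ∃ J ∈ P.outcomes I, K ∈ seqOutcomes Ps J}

/-- The relation `R` appears on the right-hand side of a tgd among the postconditions. -/
def Procedure.Produces (P : Procedure) (R : RelName) : Prop :=
  ∃ d : Tgd, Constraint.dep (.tgd d) ∈ P.post ∧ Mentions d.rhs R

structure Procedure.SafeScope (P : Procedure) : Prop where
  pre_empty : P.pre = []
  post_tgd : ∀ c ∈ P.post, ∃ d : Tgd, c = .dep (.tgd d)
  post_acyclic : AcyclicSet {d | Constraint.dep (.tgd d) ∈ P.post}
  scope_iff : ∀ c, c ∈ P.scope ↔ ∃ R, P.Produces R ∧ c = .star R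
  pres_iff : ∀ Q, Q ∈ P.pres ↔ ∃ R, StructConstraint.star R ∈ P.scope ∧ Q = .total R

/-- Everything the postconditions and preserved queries mention is in the schema. -/
def Procedure.Compatible (S : Schema) (P : Procedure) : Prop :=
  (∀ Q ∈ P.pres, Q.Compatible S) ∧
    ∀ c ∈ P.post, match c with
      | .dep d => d.Compatible S
      | .struct s => s.Holds S

/-! ### The problem `constraint readiness` -/

/-- A fact `R(A₁:v₁,…,A_k:v_k)`. -/
structure Fact where
  rel : RelName
  vals : List (Attr × Val)

/-- The tuple of a fact. -/
def Fact.tuple (f : Fact) : Tuple := fun A => List.lookup A f.vals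

/-- The instance of `S` consisting of finitely many listed facts; every instance with finitely many
tuples arises in this way.  (Entries that do not fit the schema are not facts over it.) -/
def instanceOf (S : Schema) (F : List Fact) : Instance S where
  rel := fun R => {t | S.IsTuple R t ∧ ∃ f ∈ F, f.rel = R ∧ f.tuple = t}
  isTuple := fun _ _ h => h.1

/-- An input: a finite instance `I` (schema and facts), a finite set of procedures, and a finite
set of tgds and egds. -/
structure ReadinessInput where
  schema : Schema
  facts : List Fact
  procs : List Procedure
  target : List Dependency

/-- The input instance `I`. -/
def ReadinessInput.inst (x : ReadinessInput) : Instance x.schema := instanceOf x.schema x.facts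

/-- There is a sequence of procedures of the given set such that all its outcomes on `I` satisfy
the target. -/
def ReadinessInput.Ready (x : ReadinessInput) : Prop :=
  ∃ Ps : List Procedure, (∀ P ∈ Ps, P ∈ x.procs) ∧
    ∀ J ∈ seqOutcomes Ps x.inst, ∀ c ∈ x.target, c.Holds J

/-! ### Codings of the inputs, through the evident bijections with products and sums -/

def Atom.equiv : Atom ≃ RelName × List (Attr × Var) where
  toFun a := (a.rel, a.args)
  invFun p := ⟨p.1, p.2⟩
  left_inv _ := rfl
  right_inv _ := rfl

instance : Primcodable Atom := Primcodable.ofEquiv _ Atom.equiv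

def CQ.equiv : CQ ≃ List Var × List Atom where
  toFun q := (q.free, q.atoms)
  invFun p := ⟨p.1, p.2⟩
  left_inv _ := rfl
  right_inv _ := rfl

instance : Primcodable CQ := Primcodable.ofEquiv _ CQ.equiv

def Query.equiv : Query ≃ CQ ⊕ RelName where
  toFun
    | .cq q => Sum.inl q
    | .total R => Sum.inr R
  invFun
    | Sum.inl q => .cq q
    | Sum.inr R => .total R
  left_inv q := by cases q <;> rfl
  right_inv s := by cases s <;> rfl

instance : Primcodable Query := Primcodable.ofEquiv _ Query.equiv

def Tgd.equiv : Tgd ≃ List Atom × List Atom where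
  toFun d := (d.lhs, d.rhs)
  invFun p := ⟨p.1, p.2⟩
  left_inv _ := rfl
  right_inv _ := rfl

instance : Primcodable Tgd := Primcodable.ofEquiv _ Tgd.equiv

def Egd.equiv : Egd ≃ List Atom × Var × Var where
  toFun d := (d.lhs, d.x, d.x')
  invFun p := ⟨p.1, p.2.1, p.2.2⟩
  left_inv _ := rfl
  right_inv _ := rfl

instance : Primcodable Egd := Primcodable.ofEquiv _ Egd.equiv

def Dependency.equiv : Dependency ≃ Tgd ⊕ Egd where
  toFun
    | .tgd d => Sum.inl d
    | .egd d => Sum.inr d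
  invFun
    | Sum.inl d => .tgd d
    | Sum.inr d => .egd d
  left_inv c := by cases c <;> rfl
  right_inv s := by cases s <;> rfl

instance : Primcodable Dependency := Primcodable.ofEquiv _ Dependency.equiv

def StructConstraint.equiv : StructConstraint ≃ (RelName × List Attr) ⊕ RelName where
  toFun
    | .cols R s => Sum.inl (R, s)
    | .star R => Sum.inr R
  invFun
    | Sum.inl p => .cols p.1 p.2
    | Sum.inr R => .star R
  left_inv c := by cases c <;> rfl
  right_inv s := by cases s <;> rfl

instance : Primcodable StructConstraint := Primcodable.ofEquiv _ StructConstraint.equiv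

def Constraint.equiv : Constraint ≃ Dependency ⊕ StructConstraint where
  toFun
    | .dep c => Sum.inl c
    | .struct c => Sum.inr c
  invFun
    | Sum.inl c => .dep c
    | Sum.inr c => .struct c
  left_inv c := by cases c <;> rfl
  right_inv s := by cases s <;> rfl

instance : Primcodable Constraint := Primcodable.ofEquiv _ Constraint.equiv

def Procedure.equiv :
    Procedure ≃ List StructConstraint × List Constraint × List Constraint × List Query where
  toFun P := (P.scope, P.pre, P.post, P.pres)
  invFun p := ⟨p.1, p.2.1, p.2.2.1, p.2.2.2⟩
  left_inv _ := rfl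
  right_inv _ := rfl

instance : Primcodable Procedure := Primcodable.ofEquiv _ Procedure.equiv

def Fact.equiv : Fact ≃ RelName × List (Attr × Val) where
  toFun f := (f.rel, f.vals)
  invFun p := ⟨p.1, p.2⟩
  left_inv _ := rfl
  right_inv _ := rfl

instance : Primcodable Fact := Primcodable.ofEquiv _ Fact.equiv

def ReadinessInput.equiv :
    ReadinessInput ≃ Schema × List Fact × List Procedure × List Dependency where
  toFun x := (x.schema, x.facts, x.procs, x.target)
  invFun p := ⟨p.1, p.2.1, p.2.2.1, p.2.2.2⟩
  left_inv _ := rfl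
  right_inv _ := rfl

instance : Primcodable ReadinessInput := Primcodable.ofEquiv _ ReadinessInput.equiv

end DataReadiness

namespace DataReadiness

/-! ### Instances, outcomes and safe scope -/

/-! The reduction is from halting of a fixed program `u` at an argument `n`. Evaluation of
`Nat.Partrec.Code` is axiomatised by positive rules over zero, successor, order, pairing and syntax
trees; the only existential rule says that each successor has a successor. Each rule becomes one
procedure. Every predicate has a read copy and a written copy, so that each tgd is acyclic by
itself, and separate procedures copy back. Recursion comes from repeating procedures; the target
asks for a value of `eval` at the input.

Readiness implies halting: the standard model over ℕ satisfies all the tgds and contains the initial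
instance. By `exists_seqOutcomes_below` every sequence of procedures has an outcome inside that
model, so a value of `eval` found there is a true one (`dom_of_ready`).

Halting implies readiness: outcomes may add spurious facts and choose arbitrary witnesses, but they
lose nothing, and positive rules are not disturbed by extra facts. Repeating the successor procedure
forces a chain `ν 0, ν 1, …`, possibly with repetitions (`exists_interprets`). A halting computation
has a finite derivation (`ClosedUnderRules.eval_of_mem_eval`), which a sequence of procedures
replays along `ν` (`forced_closedUnderRules`). The input relation is never in scope, so the target
only concerns `u` and `n`.

One technical point: the query that protects the relations outside the scope is a single
conjunction, and one empty relation empties its answer. Hence the initial instance has no empty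
relation. -/

theorem Schema.IsTuple.mem_rels {S : Schema} {R : RelName} {t : Tuple} (h : S.IsTuple R t) :
    R ∈ S.rels := by
  obtain ⟨X, hX, -⟩ := h
  unfold Schema.attrs at hX
  rw [Option.map_eq_some_iff] at hX
  obtain ⟨s, hs, -⟩ := hX
  rw [Schema.rels, List.mem_dedup, List.mem_map]
  obtain ⟨l₁, l₂, rfl, -⟩ := List.lookup_eq_some_iff.1 hs
  exact ⟨(R, s), by simp, rfl⟩

theorem Schema.IsTuple.isSome_iff {S : Schema} {R : RelName} {t : Tuple} (h : S.IsTuple R t)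
    (A : Attr) : (t A).isSome ↔ A ∈ S.sortedAttrs R := by
  obtain ⟨X, hX, ht⟩ := h
  simp [Schema.sortedAttrs, hX, ht]

theorem Schema.IsTuple.ext {S : Schema} {R : RelName} {t t' : Tuple} (h : S.IsTuple R t)
    (h' : S.IsTuple R t') (heq : ∀ A ∈ S.sortedAttrs R, t A = t' A) : t = t' := by
  funext A
  by_cases hA : A ∈ S.sortedAttrs R
  · exact heq A hA
  · rw [Option.not_isSome_iff_eq_none.1 (mt (h.isSome_iff A).1 hA),
      Option.not_isSome_iff_eq_none.1 (mt (h'.isSome_iff A).1 hA)]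

theorem Atom.Sat.mono {S : Schema} {I J : Instance S} (h : ∀ R, I.rel R ⊆ J.rel R) {τ : Var → Val}
    {a : Atom} (ha : a.Sat I τ) : a.Sat J τ := by
  obtain ⟨t, ht, hp⟩ := ha
  exact ⟨t, h _ ht, hp⟩

theorem rel_subset_of_total_answers {S : Schema} {I J : Instance S} {R : RelName}
    (h : (Query.total R).answers I ⊆ (Query.total R).answers J) : I.rel R ⊆ J.rel R := by
  intro t ht
  have hI := I.isTuple R t ht
  have hv : (S.sortedAttrs R).map t = ((S.sortedAttrs R).map fun A => (t A).getD 0).map some := by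
    rw [List.map_map]
    refine List.map_congr_left fun A hA => ?_
    obtain ⟨v, hv⟩ := Option.isSome_iff_exists.1 ((hI.isSome_iff A).2 hA)
    simp [hv]
  obtain ⟨t', ht', hv'⟩ := h ⟨t, ht, hv⟩
  rw [← hv] at hv'
  rwa [hI.ext (J.isTuple R t' ht') fun A hA => (List.map_inj_left.1 hv' A hA).symm]

/-- A tuple of `R` can be seen in the answers of the conjunction only if every other atom is matched
as well; nonemptiness supplies these matches. Since `C` consists of star constraints, no column is
projected away, and the answer determines the tuple. -/
theorem rel_subset_of_outside_answers {S : Schema} {I J : Instance S} {C : List StructConstraint}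
    (hne : ∀ R ∈ S.rels, (I.rel R).Nonempty) (hC : ∀ c ∈ C, ∃ R, c = .star R)
    (h : (outsideQuery S C).answers I ⊆ (outsideQuery S C).answers J) {R : RelName}
    (hR : StructConstraint.star R ∉ C) : I.rel R ⊆ J.rel R := by
  classical
  intro t ht
  have hI := I.isTuple R t ht
  have hargs : ∀ R' A, (A, Nat.pair R' A) ∈ (outsideAtom S C R').args ↔ A ∈ S.sortedAttrs R' := by
    intro R' A
    have hnone : C.any (fun c => c.mentionsAttr R' A) = false := by
      rw [List.any_eq_false]
      intro c hc
      obtain ⟨R'', rfl⟩ := hC c hc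
      simp [StructConstraint.mentionsAttr]
    simp only [outsideAtom, List.mem_map, List.mem_filter, Prod.mk.injEq]
    constructor
    · rintro ⟨B, ⟨hB, -⟩, rfl, -⟩
      exact hB
    · intro hA
      exact ⟨A, ⟨hA, by rw [hnone]; rfl⟩, rfl, rfl⟩
  -- One tuple per relation: the given `t` for `R`, an arbitrary one elsewhere. The assignment `τ`
  -- below decodes its variables by `Nat.unpair`.
  let w : RelName → Tuple := fun R' =>
    if R' = R then t else if h : (I.rel R').Nonempty then h.some else fun _ => none
  have hw : ∀ R' ∈ S.rels, w R' ∈ I.rel R' := by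
    intro R' hR'
    by_cases e : R' = R
    · subst e
      simpa [w] using ht
    · simpa [w, e, hne R' hR'] using (hne R' hR').some_mem
  let τ : Var → Val := fun v => (w v.unpair.1 v.unpair.2).getD 0
  have hτ : ∀ R' ∈ S.rels, ∀ A ∈ S.sortedAttrs R', w R' A = some (τ (Nat.pair R' A)) := by
    intro R' hR' A hA
    obtain ⟨v, hv⟩ :=
      Option.isSome_iff_exists.1 (((I.isTuple R' _ (hw R' hR')).isSome_iff A).2 hA)
    simp [τ, hv]
  have hsat : SatAll I τ (outsideQuery S C).atoms := by
    intro a ha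
    obtain ⟨R', hR', rfl⟩ := List.mem_map.1 ha
    have hR'' := (List.mem_filter.1 hR').1
    refine ⟨w R', hw R' hR'', ?_⟩
    rintro ⟨A, x⟩ hp
    obtain rfl : x = Nat.pair R' A := by
      obtain ⟨B, -, hB⟩ := List.mem_map.1 hp
      cases hB
      rfl
    exact hτ R' hR'' A ((hargs R' A).1 hp)
  obtain ⟨τ', hsat', hfree⟩ := h ⟨τ, hsat, rfl⟩
  have hRmem : outsideAtom S C R ∈ (outsideQuery S C).atoms :=
    List.mem_map_of_mem (List.mem_filter.2 ⟨hI.mem_rels, by simpa using hR⟩)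
  obtain ⟨t', ht', hp⟩ := hsat' _ hRmem
  have htt : t = t' := by
    refine hI.ext (J.isTuple R t' ht') fun A hA => ?_
    have hA' := (hargs R A).2 hA
    have hmem : Nat.pair R A ∈ (outsideQuery S C).free :=
      List.mem_flatMap.2 ⟨_, hRmem, List.mem_map_of_mem (f := Prod.snd) hA'⟩
    have h1 := hτ R hI.mem_rels A hA
    simp only [w, if_true] at h1
    rw [h1, List.map_inj_left.1 hfree _ hmem]
    exact (hp _ hA').symm
  exact htt ▸ ht'

theorem seqOutcomes_append {S : Schema} (Ps Qs : List Procedure) (I K : Instance S) :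
    K ∈ seqOutcomes (Ps ++ Qs) I ↔ ∃ J ∈ seqOutcomes Ps I, K ∈ seqOutcomes Qs J := by
  induction Ps generalizing I with
  | nil => simp [seqOutcomes]
  | cons P Ps ih =>
    simp only [List.cons_append, seqOutcomes, Set.mem_ofPred_eq, ih]
    constructor
    · rintro ⟨J, hJ, L, hL, hK⟩
      exact ⟨L, ⟨J, hJ, hL⟩, hK⟩
    · rintro ⟨L, ⟨J, hJ, hL⟩, hK⟩
      exact ⟨J, hJ, L, hL, hK⟩

/-- The procedure with safe scope whose only postcondition is the given tgd. -/
def tgdProcedure (d : Tgd) : Procedure where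
  scope := d.rhs.map fun a => .star a.rel
  pre := []
  post := [.dep (.tgd d)]
  pres := d.rhs.map fun a => .total a.rel

theorem tgdProcedure_star_mem_scope {d : Tgd} {R : RelName} :
    StructConstraint.star R ∈ (tgdProcedure d).scope ↔ Mentions d.rhs R := by
  simp [tgdProcedure, Mentions]

theorem tgdProcedure_produces {d : Tgd} {R : RelName} :
    (tgdProcedure d).Produces R ↔ Mentions d.rhs R := by
  simp [tgdProcedure, Procedure.Produces]

/-- With a single tgd, every edge runs from its left-hand to its right-hand relations, so a cycle
would put some relation on both sides. -/
theorem tgdProcedure_safeScope {d : Tgd} (hd : d.Acyclic) : (tgdProcedure d).SafeScope where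
  pre_empty := rfl
  post_tgd := by simp [tgdProcedure]
  post_acyclic := by
    have key : ∀ R R', Relation.TransGen (fun R R' => ∃ e ∈ {e | Constraint.dep (.tgd e) ∈
        (tgdProcedure d).post}, Mentions e.lhs R ∧ Mentions e.rhs R') R R' →
        Mentions d.lhs R ∧ Mentions d.rhs R' := by
      intro R R' h
      have edge : ∀ e, Constraint.dep (.tgd e) ∈ (tgdProcedure d).post → e = d := by
        simp [tgdProcedure]
      induction h with
      | single h =>
        obtain ⟨e, he, h⟩ := h
        exact edge e he ▸ h
      | tail _ h ih =>
        obtain ⟨e, he, h⟩ := h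
        exact ⟨ih.1, edge e he ▸ h.2⟩
    intro R h
    exact hd R (key R R h).2 (key R R h).1
  scope_iff := by
    intro c
    simp only [tgdProcedure_produces]
    simp only [tgdProcedure, Mentions, List.mem_map]
    constructor
    · rintro ⟨a, ha, rfl⟩
      exact ⟨_, ⟨a, ha, rfl⟩, rfl⟩
    · rintro ⟨_, ⟨a, ha, rfl⟩, rfl⟩
      exact ⟨a, ha, rfl⟩
  pres_iff := by
    intro Q
    simp only [tgdProcedure_star_mem_scope]
    simp only [tgdProcedure, Mentions, List.mem_map]
    constructor
    · rintro ⟨a, ha, rfl⟩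
      exact ⟨_, ⟨a, ha, rfl⟩, rfl⟩
    · rintro ⟨_, ⟨a, ha, rfl⟩, rfl⟩
      exact ⟨a, ha, rfl⟩

theorem tgdProcedure_compatible {S : Schema} {d : Tgd} (hd : (Dependency.tgd d).Compatible S) :
    (tgdProcedure d).Compatible S := by
  constructor
  · intro Q hQ
    obtain ⟨a, ha, rfl⟩ := List.mem_map.1 hQ
    obtain ⟨X, hX, -⟩ := hd.2 a ha
    simp [Query.Compatible, hX]
  · intro c hc
    obtain rfl : c = .dep (.tgd d) := by simpa [tgdProcedure] using hc
    exact hd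

/-! ### What outcomes must preserve, and how small they can be -/

section Outcomes

variable {S : Schema} {d : Tgd} {I J : Instance S}

theorem tgdProcedure_outcome_holds (h : J ∈ (tgdProcedure d).outcomes I) : d.Holds J :=
  (h.2.1 (.dep (.tgd d)) (by simp [tgdProcedure])).2

theorem tgdProcedure_outcome_rel_eq (hne : ∀ R ∈ S.rels, (I.rel R).Nonempty)
    (h : J ∈ (tgdProcedure d).outcomes I) {R : RelName} (hR : ¬ Mentions d.rhs R) :
    J.rel R = I.rel R := by
  have hC : ∀ c ∈ (tgdProcedure d).scope, ∃ R, c = .star R := by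
    intro c hc
    obtain ⟨a, -, rfl⟩ := List.mem_map.1 hc
    exact ⟨_, rfl⟩
  have hpres : ∀ R, Mentions d.rhs R → I.rel R ⊆ J.rel R := by
    rintro R ⟨a, ha, rfl⟩
    exact rel_subset_of_total_answers (h.2.2.2 _ (List.mem_map_of_mem ha))
  have hsub : ∀ R, I.rel R ⊆ J.rel R := by
    intro R
    by_cases hR : Mentions d.rhs R
    · exact hpres R hR
    · exact rel_subset_of_outside_answers hne hC h.2.2.1.le
        (mt tgdProcedure_star_mem_scope.1 hR)
  -- Equality of the answers is used in the other direction too; `J` has no empty relation because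
  -- it contains `I`.
  exact (rel_subset_of_outside_answers (fun R hR => (hne R hR).mono (hsub R)) hC h.2.2.1.ge
    (mt tgdProcedure_star_mem_scope.1 hR)).antisymm (hsub R)

theorem tgdProcedure_outcome_subset (hne : ∀ R ∈ S.rels, (I.rel R).Nonempty)
    (h : J ∈ (tgdProcedure d).outcomes I) (R : RelName) : I.rel R ⊆ J.rel R := by
  by_cases hR : Mentions d.rhs R
  · obtain ⟨a, ha, rfl⟩ := hR
    exact rel_subset_of_total_answers (h.2.2.2 _ (List.mem_map_of_mem ha))
  · exact (tgdProcedure_outcome_rel_eq hne h hR).ge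

/-- Below a model `M` of an acyclic tgd there is an outcome of the procedure for the tgd. -/
theorem exists_tgdProcedure_outcome {M : Instance S} (hd : (Dependency.tgd d).Compatible S)
    (hM : d.Holds M) (hI : ∀ R, I.rel R ⊆ M.rel R) :
    ∃ J ∈ (tgdProcedure d).outcomes I, (∀ R, I.rel R ⊆ J.rel R) ∧ ∀ R, J.rel R ⊆ M.rel R := by
  classical
  -- Only the relations in scope are changed, and there `M` is copied entirely: a match of the
  -- left-hand side in `J` is a match in `M`, and the witnesses that `M` offers all lie in `J`.
  let J : Instance S :=
    { rel := fun R => if Mentions d.rhs R then M.rel R else I.rel R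
      isTuple := by
        intro R t ht
        split_ifs at ht
        · exact M.isTuple R t ht
        · exact I.isTuple R t ht }
  have hIJ : ∀ R, I.rel R ⊆ J.rel R := by
    intro R
    by_cases hR : Mentions d.rhs R
    · simpa [J, hR] using hI R
    · simp [J, hR]
  have hJM : ∀ R, J.rel R ⊆ M.rel R := by
    intro R
    by_cases hR : Mentions d.rhs R
    · simp [J, hR]
    · simpa [J, hR] using hI R
  refine ⟨J, ⟨⟨(tgdProcedure_compatible hd).1, by simp [tgdProcedure]⟩, ?_, ?_, ?_⟩, hIJ, hJM⟩
  · intro c hc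
    obtain rfl : c = .dep (.tgd d) := by simpa [tgdProcedure] using hc
    refine ⟨hd, fun τ hτ => ?_⟩
    obtain ⟨τ', h1, h2⟩ := hM τ fun a ha => (hτ a ha).mono hJM
    refine ⟨τ', h1, fun a ha => ?_⟩
    obtain ⟨t, ht, hp⟩ := h2 a ha
    exact ⟨t, by simpa [J, show Mentions d.rhs a.rel from ⟨a, ha, rfl⟩] using ht, hp⟩
  · have key : ∀ τ, SatAll I τ (outsideQuery S (tgdProcedure d).scope).atoms ↔
        SatAll J τ (outsideQuery S (tgdProcedure d).scope).atoms := by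
      intro τ
      refine forall₂_congr fun a ha => ?_
      obtain ⟨R, hR, rfl⟩ := List.mem_map.1 ha
      have hR' : ¬ Mentions d.rhs R := by
        simpa [tgdProcedure_star_mem_scope] using (List.mem_filter.1 hR).2
      simp [Atom.Sat, outsideAtom, J, hR']
    simp only [CQ.answers, key]
  · intro Q hQ
    obtain ⟨a, ha, rfl⟩ := List.mem_map.1 hQ
    rintro v ⟨t, ht, hv⟩
    exact ⟨t, hIJ _ ht, hv⟩

theorem exists_seqOutcomes_below {M : Instance S} {D : List Tgd}
    (hD : ∀ d ∈ D, (Dependency.tgd d).Compatible S) (hM : ∀ d ∈ D, d.Holds M) (Ps : List Procedure)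
    (hPs : ∀ P ∈ Ps, P ∈ D.map tgdProcedure) (I : Instance S) (hI : ∀ R, I.rel R ⊆ M.rel R) :
    ∃ J ∈ seqOutcomes Ps I, (∀ R, I.rel R ⊆ J.rel R) ∧ ∀ R, J.rel R ⊆ M.rel R := by
  induction Ps generalizing I with
  | nil => exact ⟨I, rfl, fun _ => subset_rfl, hI⟩
  | cons P Ps ih =>
    obtain ⟨d, hd, rfl⟩ := List.mem_map.1 (hPs P (by simp))
    obtain ⟨J, hJ, hIJ, hJM⟩ := exists_tgdProcedure_outcome (hD d hd) (hM d hd) hI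
    obtain ⟨K, hK, hJK, hKM⟩ := ih (fun P hP => hPs P (by simp [hP])) J hJM
    exact ⟨K, ⟨J, hJ, hK⟩, fun R => (hIJ R).trans (hJK R), hKM⟩

end Outcomes

end DataReadiness

namespace DataReadiness

/-! ### Literals over ternary predicates, and their two copies -/

/-- The tuple with the given values at the attributes `0`, `1`, `2`. -/
def triple (x y z : Val) : Tuple := fun A => List.lookup A [(0, x), (1, y), (2, z)]

/-- Each of the 14 predicates `k` has two ternary relations: `2 * k`, which is read by the rules, and
`2 * k + 1`, into which the rules write. -/
def ternSchema : Schema := (List.range 28).map fun R => (R, [0, 1, 2])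

theorem ternSchema_attrs_of_lt {R : RelName} (h : R < 28) :
    ternSchema.attrs R = some {0, 1, 2} := by
  revert R
  decide

theorem ternSchema_attrs_of_le {R : RelName} (h : 28 ≤ R) : ternSchema.attrs R = none := by
  simp only [Schema.attrs, Option.map_eq_none_iff, List.lookup_eq_none_iff]
  intro p hp
  obtain ⟨R', hR', rfl⟩ := List.mem_map.1 hp
  simpa using (lt_of_lt_of_le (List.mem_range.1 hR') h).ne'

theorem ternSchema_isTuple_iff {R : RelName} {t : Tuple} :
    ternSchema.IsTuple R t ↔ R < 28 ∧ ∃ x y z, t = triple x y z := by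
  constructor
  · rintro ⟨X, hX, ht⟩
    rcases lt_or_ge R 28 with hR | hR
    · refine ⟨hR, ?_⟩
      rw [ternSchema_attrs_of_lt hR] at hX
      cases hX
      obtain ⟨x, hx⟩ := Option.isSome_iff_exists.1 ((ht 0).2 (by simp))
      obtain ⟨y, hy⟩ := Option.isSome_iff_exists.1 ((ht 1).2 (by simp))
      obtain ⟨z, hz⟩ := Option.isSome_iff_exists.1 ((ht 2).2 (by simp))
      refine ⟨x, y, z, ?_⟩
      funext A
      match A with
      | 0 => exact hx
      | 1 => exact hy
      | 2 => exact hz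
      | A + 3 =>
        rw [Option.not_isSome_iff_eq_none.1 (mt (ht (A + 3)).1 (by simp))]
        rfl
    · rw [ternSchema_attrs_of_le hR] at hX
      cases hX
  · rintro ⟨hR, x, y, z, rfl⟩
    refine ⟨_, ternSchema_attrs_of_lt hR, fun A => ?_⟩
    match A with
    | 0 => simp [triple]
    | 1 => simp [triple, List.lookup]
    | 2 => simp [triple, List.lookup]
    | A + 3 => simp [triple, List.lookup]

theorem triple_inj {x y z x' y' z' : Val} :
    triple x y z = triple x' y' z' ↔ x = x' ∧ y = y' ∧ z = z' := by
  constructor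
  · intro h
    exact ⟨Option.some.inj (congrFun h 0), Option.some.inj (congrFun h 1),
      Option.some.inj (congrFun h 2)⟩
  · rintro ⟨rfl, rfl, rfl⟩
    rfl

/-- A predicate with three arguments, which are variables or values. -/
abbrev Lit : Type := ℕ × ℕ × ℕ × ℕ

namespace Lit

/-- Predicates of smaller arity repeat their last argument, so that one ternary schema serves for
all of them. -/
abbrev zero (x : ℕ) : Lit := (0, x, x, x)
abbrev succ (x y : ℕ) : Lit := (1, x, y, y)
abbrev lt (x y : ℕ) : Lit := (2, x, y, y)
abbrev pair (x y z : ℕ) : Lit := (3, x, y, z)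
/-- The program with code `c` has the value `y` at `x`. -/
abbrev eval (c x y : ℕ) : Lit := (4, c, x, y)
abbrev input (c x : ℕ) : Lit := (5, c, x, x)
abbrev codeZero (c : ℕ) : Lit := (6, c, c, c)
abbrev codeSucc (c : ℕ) : Lit := (7, c, c, c)
abbrev codeLeft (c : ℕ) : Lit := (8, c, c, c)
abbrev codeRight (c : ℕ) : Lit := (9, c, c, c)
abbrev codePair (c f g : ℕ) : Lit := (10, c, f, g)
abbrev codeComp (c f g : ℕ) : Lit := (11, c, f, g)
abbrev codePrec (c f g : ℕ) : Lit := (12, c, f, g)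
abbrev codeRfind (c f : ℕ) : Lit := (13, c, f, f)

def map (σ : ℕ → ℕ) (l : Lit) : Lit := (l.1, σ l.2.1, σ l.2.2.1, σ l.2.2.2)

def args (l : Lit) : List ℕ := [l.2.1, l.2.2.1, l.2.2.2]

/-- The atom for the copy `b` of the predicate. -/
def atom (b : ℕ) (l : Lit) : Atom :=
  ⟨2 * l.1 + b, [(0, l.2.1), (1, l.2.2.1), (2, l.2.2.2)]⟩

/-- The fact for the copy `b` of the predicate. -/
def fact (b : ℕ) (l : Lit) : Fact :=
  ⟨2 * l.1 + b, [(0, l.2.1), (1, l.2.2.1), (2, l.2.2.2)]⟩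

/-- The copy `b` of the literal holds in the instance. -/
def HoldsIn (J : Instance ternSchema) (b : ℕ) (l : Lit) : Prop :=
  triple l.2.1 l.2.2.1 l.2.2.2 ∈ J.rel (2 * l.1 + b)

theorem atom_sat_iff {J : Instance ternSchema} {τ : Var → Val} {b : ℕ} {l : Lit} :
    (l.atom b).Sat J τ ↔ (l.map τ).HoldsIn J b := by
  constructor
  · rintro ⟨t, ht, hp⟩
    obtain ⟨-, x, y, z, rfl⟩ := ternSchema_isTuple_iff.1 (J.isTuple _ t ht)
    obtain rfl : x = τ l.2.1 := Option.some.inj (hp (0, l.2.1) (by simp [atom]))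
    obtain rfl : y = τ l.2.2.1 := Option.some.inj (hp (1, l.2.2.1) (by simp [atom]))
    obtain rfl : z = τ l.2.2.2 := Option.some.inj (hp (2, l.2.2.2) (by simp [atom]))
    exact ht
  · intro h
    refine ⟨_, h, ?_⟩
    simp [atom, triple, map, List.lookup]

theorem atom_compatible {b : ℕ} {l : Lit} (hl : l.1 < 14) (hb : b < 2) :
    (l.atom b).Compatible ternSchema :=
  ⟨_, ternSchema_attrs_of_lt (show 2 * l.1 + b < 28 by omega), by simp [atom]⟩

theorem mem_vars_atom {b : ℕ} {l : Lit} {v : Var} : v ∈ (l.atom b).vars ↔ v ∈ l.args := by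
  simp [atom, Atom.vars, args]

theorem HoldsIn.mono {J K : Instance ternSchema} (h : ∀ R, J.rel R ⊆ K.rel R) {b : ℕ} {l : Lit}
    (hl : l.HoldsIn J b) : l.HoldsIn K b :=
  h _ hl

end Lit

/-! ### The rules -/

structure Rule where
  body : List Lit
  head : Lit

def Rule.tgd (r : Rule) : Tgd := ⟨r.body.map (Lit.atom 0), [r.head.atom 1]⟩

/-- The tgd that makes the written copy of a predicate available for reading. -/
def copyTgd (k : ℕ) : Tgd := ⟨[Lit.atom 1 (k, 0, 1, 2)], [Lit.atom 0 (k, 0, 1, 2)]⟩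

/-- Each successor has a successor. -/
def succRule : Rule := ⟨[.succ 0 1], .succ 1 2⟩

/-- The rules without existential variables: order, pairing in the order of `Nat.pair`, and
evaluation of programs. -/
def datalogRules : List Rule :=
  [⟨[.zero 0, .succ 1 2], .lt 0 2⟩,
   ⟨[.lt 0 1, .succ 0 2, .succ 1 3], .lt 2 3⟩,
   -- These four rules pass from the pair numbered `m` to the one numbered `m + 1`: along the shell
   -- `(0,k), …, (k-1,k), (k,0), …, (k,k)` and on to `(0,k+1)`.
   ⟨[.pair 0 1 2, .succ 0 3, .lt 3 1, .succ 2 4], .pair 3 1 4⟩,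
   ⟨[.pair 0 1 2, .succ 0 1, .zero 3, .succ 2 4], .pair 1 3 4⟩,
   ⟨[.pair 0 1 2, .lt 1 0, .succ 1 3, .succ 2 4], .pair 0 3 4⟩,
   ⟨[.pair 0 0 1, .succ 0 2, .zero 3, .succ 1 4], .pair 3 2 4⟩,
   -- The atom `succ 1 2` only binds the argument 1, so that no head variable is existential.
   ⟨[.codeZero 0, .succ 1 2, .zero 3], .eval 0 1 3⟩,
   ⟨[.codeSucc 0, .succ 1 2], .eval 0 1 2⟩,
   ⟨[.codeLeft 0, .pair 1 2 3], .eval 0 3 1⟩,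
   ⟨[.codeRight 0, .pair 1 2 3], .eval 0 3 2⟩,
   ⟨[.codePair 0 1 2, .eval 1 3 4, .eval 2 3 5, .pair 4 5 6], .eval 0 3 6⟩,
   ⟨[.codeComp 0 1 2, .eval 2 3 4, .eval 1 4 5], .eval 0 3 5⟩,
   ⟨[.codePrec 0 1 2, .pair 3 4 5, .zero 4, .eval 1 3 6], .eval 0 5 6⟩,
   ⟨[.codePrec 0 1 2, .pair 3 4 5, .eval 0 5 6, .succ 4 7, .pair 4 6 8, .pair 3 8 9, .eval 2 9 10,
      .pair 3 7 11], .eval 0 11 10⟩,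
   -- Unbounded search from 3: stop at the value zero, move on to the next number at a successor
   -- value.
   ⟨[.codeRfind 0 1, .pair 2 3 4, .eval 1 4 5, .zero 5], .eval 0 4 3⟩,
   ⟨[.codeRfind 0 1, .pair 2 3 4, .eval 1 4 5, .succ 6 5, .succ 3 7, .pair 2 7 8, .eval 0 8 9],
      .eval 0 4 9⟩]

/-- The predicates that occur in heads of rules. -/
def derivedPreds : List ℕ := [1, 2, 3, 4]

def readinessTgds : List Tgd :=
  succRule.tgd :: (datalogRules.map Rule.tgd ++ derivedPreds.map copyTgd)

def targetTgd : Tgd := ⟨[Lit.atom 0 (.input 0 1)], [Lit.atom 0 (.eval 0 1 2)]⟩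

theorem datalogRules_vars : ∀ r ∈ datalogRules, ∀ v ∈ r.head.args, ∃ l ∈ r.body, v ∈ l.args := by
  decide

theorem datalogRules_preds :
    ∀ r ∈ datalogRules, (∀ l ∈ r.body, l.1 < 14) ∧ r.head.1 ∈ derivedPreds := by
  decide

theorem lt_of_mem_derivedPreds {k : ℕ} (h : k ∈ derivedPreds) : k < 14 ∧ k ≠ 5 := by
  revert k
  decide

/-- Parity: bodies use even relation names, heads odd ones. -/
theorem Rule.tgd_acyclic (r : Rule) : r.tgd.Acyclic := by
  rintro R ⟨a, ha, rfl⟩ ⟨a', ha', he⟩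
  simp only [Rule.tgd, List.mem_singleton, List.mem_map] at ha ha'
  subst ha
  obtain ⟨l, -, rfl⟩ := ha'
  have he' : 2 * l.1 + 0 = 2 * r.head.1 + 1 := he
  omega

theorem copyTgd_acyclic (k : ℕ) : (copyTgd k).Acyclic := by
  rintro R ⟨a, ha, rfl⟩ ⟨a', ha', he⟩
  simp only [copyTgd, List.mem_singleton] at ha ha'
  subst ha ha'
  have he' : 2 * k + 1 = 2 * k + 0 := he
  omega

theorem targetTgd_acyclic : targetTgd.Acyclic := by
  rintro R ⟨a, ha, rfl⟩ ⟨a', ha', he⟩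
  simp only [targetTgd, List.mem_singleton] at ha ha'
  subst ha ha'
  simp [Lit.atom] at he

theorem readinessTgds_cases {p : Tgd → Prop} (hs : p succRule.tgd)
    (hr : ∀ r ∈ datalogRules, p r.tgd) (hc : ∀ k ∈ derivedPreds, p (copyTgd k)) :
    ∀ d ∈ readinessTgds, p d := by
  simpa [readinessTgds, or_imp, forall_and] using ⟨hs, hr, hc⟩

theorem readinessTgds_acyclic : ∀ d ∈ readinessTgds, d.Acyclic :=
  readinessTgds_cases (Rule.tgd_acyclic _) (fun _ _ => Rule.tgd_acyclic _)
    fun _ _ => copyTgd_acyclic _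

theorem Rule.tgd_compatible {r : Rule} (hb : ∀ l ∈ r.body, l.1 < 14) (hh : r.head.1 < 14) :
    (Dependency.tgd r.tgd).Compatible ternSchema := by
  constructor
  · intro a ha
    obtain ⟨l, hl, rfl⟩ := List.mem_map.1 ha
    exact Lit.atom_compatible (hb l hl) (by omega)
  · intro a ha
    obtain rfl := List.mem_singleton.1 ha
    exact Lit.atom_compatible hh (by omega)

theorem readinessTgds_compatible :
    ∀ d ∈ readinessTgds, (Dependency.tgd d).Compatible ternSchema := by
  refine readinessTgds_cases (Rule.tgd_compatible (by decide) (by decide)) (fun r hr => ?_)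
    fun k hk => ⟨fun a ha => ?_, fun a ha => ?_⟩
  · have := datalogRules_preds r hr
    exact Rule.tgd_compatible this.1 (lt_of_mem_derivedPreds this.2).1
  all_goals
    obtain rfl := List.mem_singleton.1 ha
    exact Lit.atom_compatible (lt_of_mem_derivedPreds hk).1 (by omega)

theorem targetTgd_compatible : (Dependency.tgd targetTgd).Compatible ternSchema := by
  constructor <;> intro a ha <;> obtain rfl := List.mem_singleton.1 ha <;>
    exact Lit.atom_compatible (by decide) (by decide)

/-- Relation `10 = 2 * 5 + 0` is the read copy of the input. As it is never in scope, no outcome can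
add inputs for which the target would also have to hold. -/
theorem readinessTgds_not_mentions_input :
    ∀ d ∈ readinessTgds, ¬ Mentions d.rhs 10 := by
  refine readinessTgds_cases ?_ (fun r hr => ?_) fun k hk => ?_
  · rintro ⟨a, ha, he⟩
    obtain rfl := List.mem_singleton.1 ha
    simp [Lit.atom, succRule] at he
  · rintro ⟨a, ha, he⟩
    obtain rfl := List.mem_singleton.1 ha
    have he' : 2 * r.head.1 + 1 = 10 := he
    omega
  · rintro ⟨a, ha, he⟩
    obtain rfl := List.mem_singleton.1 ha
    have he' : 2 * k + 0 = 10 := he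
    have := (lt_of_mem_derivedPreds hk).2
    omega

/-! ### The standard model -/

open Nat.Partrec (Code)
open Denumerable (ofNat)

theorem pair_succ_of_succ_lt {a b : ℕ} (h : a + 1 < b) :
    Nat.pair (a + 1) b = Nat.pair a b + 1 := by
  rw [Nat.pair, Nat.pair, if_pos h, if_pos (by omega)]
  ring

theorem pair_succ_zero (a : ℕ) : Nat.pair (a + 1) 0 = Nat.pair a (a + 1) + 1 := by
  rw [Nat.pair, Nat.pair, if_neg (by omega), if_pos (by omega)]
  ring

theorem pair_succ_right_of_lt {a b : ℕ} (h : b < a) : Nat.pair a (b + 1) = Nat.pair a b + 1 := by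
  rw [Nat.pair, Nat.pair, if_neg (by omega), if_neg (by omega)]
  ring

theorem pair_zero_succ (a : ℕ) : Nat.pair 0 (a + 1) = Nat.pair a a + 1 := by
  rw [Nat.pair, Nat.pair, if_pos (by omega), if_neg (by omega)]
  ring

theorem mem_eval_pair_iff {f g : Code} {x y : ℕ} :
    y ∈ (Code.pair f g).eval x ↔ ∃ a ∈ f.eval x, ∃ b ∈ g.eval x, Nat.pair a b = y := by
  simp [Code.eval, Seq.seq]

theorem mem_eval_comp_iff {f g : Code} {x y : ℕ} :
    y ∈ (Code.comp f g).eval x ↔ ∃ a ∈ g.eval x, y ∈ f.eval a :=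
  Part.mem_bind_iff

theorem mem_eval_prec_succ_iff {f g : Code} {a n y : ℕ} :
    y ∈ (Code.prec f g).eval (Nat.pair a (n + 1)) ↔
      ∃ i ∈ (Code.prec f g).eval (Nat.pair a n), y ∈ g.eval (Nat.pair a (Nat.pair n i)) := by
  rw [Code.eval_prec_succ]
  simp

/-- Nonzero earlier values are written as `v + 1` because the rules are positive and recognise a
nonzero value only by a `succ` atom. -/
theorem mem_eval_rfind'_iff {f : Code} {a m y : ℕ} :
    y ∈ (Code.rfind' f).eval (Nat.pair a m) ↔ ∃ k, y = k + m ∧ 0 ∈ f.eval (Nat.pair a (k + m)) ∧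
      ∀ j < k, ∃ v, v + 1 ∈ f.eval (Nat.pair a (j + m)) := by
  simp only [Code.eval, Nat.unpaired, Nat.unpair_pair, Part.mem_map_iff]
  constructor
  · rintro ⟨k, hk, rfl⟩
    obtain ⟨h0, hj⟩ := Nat.mem_rfind.1 hk
    refine ⟨k, rfl, by simpa using h0, fun j hj' => ?_⟩
    obtain ⟨v, hv, hv'⟩ : ∃ v ∈ f.eval (Nat.pair a (j + m)), v ≠ 0 := by simpa using hj hj'
    exact ⟨v - 1, by rwa [Nat.sub_add_cancel (by omega)]⟩
  · rintro ⟨k, rfl, h0, hj⟩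
    refine ⟨k, Nat.mem_rfind.2 ⟨by simpa using h0, fun {j} hj' => ?_⟩, rfl⟩
    obtain ⟨v, hv⟩ := hj j hj'
    simpa using ⟨v + 1, hv, by omega⟩

theorem mem_eval_rfind'_of_zero {f : Code} {a m : ℕ} (h : 0 ∈ f.eval (Nat.pair a m)) :
    m ∈ (Code.rfind' f).eval (Nat.pair a m) :=
  mem_eval_rfind'_iff.2 ⟨0, by simp, by simpa using h, by simp⟩

theorem mem_eval_rfind'_of_succ {f : Code} {a m v y : ℕ} (h : v + 1 ∈ f.eval (Nat.pair a m))
    (hy : y ∈ (Code.rfind' f).eval (Nat.pair a (m + 1))) :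
    y ∈ (Code.rfind' f).eval (Nat.pair a m) := by
  obtain ⟨k, rfl, h0, hj⟩ := mem_eval_rfind'_iff.1 hy
  refine mem_eval_rfind'_iff.2 ⟨k + 1, by ring, by rwa [add_right_comm k 1 m], fun j hj' => ?_⟩
  rcases j with _ | j
  · exact ⟨v, by simpa using h⟩
  · simpa [add_assoc, add_comm 1 m] using hj j (by omega)

/-- The meaning of the predicates over the natural numbers. -/
def Lit.IsTrue : Lit → Prop
  | (0, x, _, _) => x = 0
  | (1, x, y, _) => y = x + 1
  | (2, x, y, _) => x < y
  | (3, x, y, z) => z = Nat.pair x y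
  | (4, c, x, y) => y ∈ (ofNat Code c).eval x
  -- Admitting every input makes one model contain the initial instances for all `u` and `n`; the
  -- procedures' tgds do not mention this predicate.
  | (5, _, _, _) => True
  | (6, c, _, _) => ofNat Code c = .zero
  | (7, c, _, _) => ofNat Code c = .succ
  | (8, c, _, _) => ofNat Code c = .left
  | (9, c, _, _) => ofNat Code c = .right
  | (10, c, f, g) => ofNat Code c = .pair (ofNat Code f) (ofNat Code g)
  | (11, c, f, g) => ofNat Code c = .comp (ofNat Code f) (ofNat Code g)
  | (12, c, f, g) => ofNat Code c = .prec (ofNat Code f) (ofNat Code g)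
  | (13, c, f, _) => ofNat Code c = .rfind' (ofNat Code f)
  | _ => False

def standardModel : Instance ternSchema where
  rel R := {t | R < 28 ∧ ∃ x y z, t = triple x y z ∧ Lit.IsTrue (R / 2, x, y, z)}
  isTuple := by
    rintro R t ⟨hR, x, y, z, rfl, -⟩
    exact ternSchema_isTuple_iff.2 ⟨hR, x, y, z, rfl⟩

theorem holdsIn_standardModel_iff {b : ℕ} (hb : b < 2) {l : Lit} :
    l.HoldsIn standardModel b ↔ l.1 < 14 ∧ l.IsTrue := by
  have h2 : (2 * l.1 + b) / 2 = l.1 := by omega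
  constructor
  · rintro ⟨hR, x, y, z, ht, h⟩
    obtain ⟨rfl, rfl, rfl⟩ := triple_inj.1 ht
    rw [h2] at h
    have hR' : 2 * l.1 + b < 28 := hR
    exact ⟨by omega, h⟩
  · rintro ⟨hl, h⟩
    exact ⟨show 2 * l.1 + b < 28 by omega, _, _, _, rfl, by rwa [h2]⟩

/-- Each rule is an instance of a recursion equation for `Nat.pair` or `Code.eval`. -/
theorem datalogRules_sound (σ : Var → ℕ) :
    ∀ r ∈ datalogRules, (∀ l ∈ r.body, (l.map σ).IsTrue) → (r.head.map σ).IsTrue := by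
  simp only [datalogRules, List.forall_mem_cons, List.not_mem_nil, false_imp_iff, implies_true,
    and_true, Lit.map, Lit.IsTrue]
  refine ⟨?_, ?_, ?_, ?_, ?_, ?_, ?_, ?_, ?_, ?_, ?_, ?_, ?_, ?_, ?_, ?_⟩
  · omega
  · omega
  · rintro ⟨h, h1, h2, h3⟩
    rw [h3, h, h1, pair_succ_of_succ_lt (h1 ▸ h2)]
  · rintro ⟨h, h1, h2, h3⟩
    rw [h3, h, h1, h2, pair_succ_zero]
  · rintro ⟨h, h1, h2, h3⟩
    rw [h3, h, h2, pair_succ_right_of_lt h1]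
  · rintro ⟨h, h1, h2, h3⟩
    rw [h3, h, h1, h2, pair_zero_succ]
  · rintro ⟨h, h1, h2⟩
    simp [h, h2, Code.eval, pure, PFun.pure]
  · rintro ⟨h, h1⟩
    simp [h, h1, Code.eval]
  · rintro ⟨h, h1⟩
    simp [h, h1, Code.eval]
  · rintro ⟨h, h1⟩
    simp [h, h1, Code.eval]
  · rintro ⟨h, h1, h2, h3⟩
    rw [h, mem_eval_pair_iff]
    exact ⟨_, h1, _, h2, h3.symm⟩
  · rintro ⟨h, h1, h2⟩
    rw [h, mem_eval_comp_iff]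
    exact ⟨_, h1, h2⟩
  · rintro ⟨h, h1, h2, h3⟩
    rw [h, h1, h2, Code.eval_prec_zero]
    exact h3
  · rintro ⟨h, h1, h2, h3, h4, h5, h6, h7⟩
    rw [h, h7, h3, mem_eval_prec_succ_iff]
    rw [h, h1] at h2
    rw [h5, h4] at h6
    exact ⟨_, h2, h6⟩
  · rintro ⟨h, h1, h2, h3⟩
    rw [h1, h3] at h2
    rw [h, h1]
    exact mem_eval_rfind'_of_zero h2
  · rintro ⟨h, h1, h2, h3, h4, h5, h6⟩
    rw [h1, h3] at h2
    rw [h, h5, h4] at h6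
    rw [h, h1]
    exact mem_eval_rfind'_of_succ h2 h6

theorem readinessTgds_standardModel : ∀ d ∈ readinessTgds, d.Holds standardModel := by
  refine readinessTgds_cases (fun τ hτ => ?_) (fun r hr τ hτ => ?_) fun k hk τ hτ => ?_
  · refine ⟨Function.update τ 2 (τ 1 + 1), fun a ha x hx => ?_, fun a ha => ?_⟩
    · obtain rfl := List.mem_singleton.1 ha
      simp only [Lit.mem_vars_atom, Lit.args] at hx
      rw [Function.update_of_ne (by rintro rfl; simp at hx)]
    · obtain rfl := List.mem_singleton.1 ha
      rw [Lit.atom_sat_iff, holdsIn_standardModel_iff (by omega)]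
      simp [succRule, Lit.map, Lit.IsTrue]
  · refine ⟨τ, fun _ _ _ _ => rfl, fun a ha => ?_⟩
    obtain rfl := List.mem_singleton.1 ha
    rw [Lit.atom_sat_iff, holdsIn_standardModel_iff (by omega)]
    refine ⟨(lt_of_mem_derivedPreds (datalogRules_preds r hr).2).1,
      datalogRules_sound τ r hr fun l hl => ?_⟩
    have := hτ _ (List.mem_map_of_mem hl)
    rw [Lit.atom_sat_iff, holdsIn_standardModel_iff (by omega)] at this
    exact this.2
  · refine ⟨τ, fun _ _ _ _ => rfl, fun a ha => ?_⟩
    obtain rfl := List.mem_singleton.1 ha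
    have := hτ _ (List.mem_singleton_self _)
    rw [Lit.atom_sat_iff, holdsIn_standardModel_iff (by omega)] at this ⊢
    exact this

end DataReadiness

namespace DataReadiness

/-! ### Completeness of the rules -/

open Nat.Partrec (Code)
open Encodable (encode)

/-- The predicate on literals is closed under the rules without existential variables. -/
structure ClosedUnderRules (Φ : Lit → Prop) : Prop where
  lt_zero : ∀ {x y z}, Φ (.zero x) → Φ (.succ y z) → Φ (.lt x z)
  lt_succ : ∀ {x y x' y'}, Φ (.lt x y) → Φ (.succ x x') → Φ (.succ y y') → Φ (.lt x' y')
  pair_left : ∀ {a b c a' c'}, Φ (.pair a b c) → Φ (.succ a a') → Φ (.lt a' b) → Φ (.succ c c') →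
    Φ (.pair a' b c')
  pair_left_end : ∀ {a b c z c'}, Φ (.pair a b c) → Φ (.succ a b) → Φ (.zero z) → Φ (.succ c c') →
    Φ (.pair b z c')
  pair_right : ∀ {a b c b' c'}, Φ (.pair a b c) → Φ (.lt b a) → Φ (.succ b b') → Φ (.succ c c') →
    Φ (.pair a b' c')
  pair_right_end : ∀ {a c a' z c'}, Φ (.pair a a c) → Φ (.succ a a') → Φ (.zero z) →
    Φ (.succ c c') → Φ (.pair z a' c')
  eval_zero : ∀ {c x x' z}, Φ (.codeZero c) → Φ (.succ x x') → Φ (.zero z) → Φ (.eval c x z)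
  eval_succ : ∀ {c x y}, Φ (.codeSucc c) → Φ (.succ x y) → Φ (.eval c x y)
  eval_left : ∀ {c a b x}, Φ (.codeLeft c) → Φ (.pair a b x) → Φ (.eval c x a)
  eval_right : ∀ {c a b x}, Φ (.codeRight c) → Φ (.pair a b x) → Φ (.eval c x b)
  eval_pair : ∀ {c f g x a b y}, Φ (.codePair c f g) → Φ (.eval f x a) → Φ (.eval g x b) →
    Φ (.pair a b y) → Φ (.eval c x y)
  eval_comp : ∀ {c f g x a y}, Φ (.codeComp c f g) → Φ (.eval g x a) → Φ (.eval f a y) →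
    Φ (.eval c x y)
  eval_prec_zero : ∀ {c f g a z x y}, Φ (.codePrec c f g) → Φ (.pair a z x) → Φ (.zero z) →
    Φ (.eval f a y) → Φ (.eval c x y)
  eval_prec_succ : ∀ {c f g a n x i n' p q y x'}, Φ (.codePrec c f g) → Φ (.pair a n x) →
    Φ (.eval c x i) → Φ (.succ n n') → Φ (.pair n i p) → Φ (.pair a p q) → Φ (.eval g q y) →
    Φ (.pair a n' x') → Φ (.eval c x' y)
  eval_rfind_zero : ∀ {c f a m x z}, Φ (.codeRfind c f) → Φ (.pair a m x) → Φ (.eval f x z) →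
    Φ (.zero z) → Φ (.eval c x m)
  eval_rfind_succ : ∀ {c f a m x v w m' x' y}, Φ (.codeRfind c f) → Φ (.pair a m x) →
    Φ (.eval f x v) → Φ (.succ w v) → Φ (.succ m m') → Φ (.pair a m' x') → Φ (.eval c x' y) →
    Φ (.eval c x y)

theorem closedUnderRules_of_datalogRules {Φ : Lit → Prop}
    (h : ∀ r ∈ datalogRules, ∀ σ : Var → ℕ, (∀ l ∈ r.body, Φ (l.map σ)) → Φ (r.head.map σ)) :
    ClosedUnderRules Φ := by
  -- Assignments given by lists of values let each substituted rule compute to the corresponding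
  -- field.
  have h' : ∀ r ∈ datalogRules, ∀ vals : List ℕ, (∀ l ∈ r.body, Φ (l.map fun v => vals.getD v 0)) →
      Φ (r.head.map fun v => vals.getD v 0) := fun r hr vals => h r hr _
  simp only [datalogRules, List.forall_mem_cons, List.not_mem_nil, false_imp_iff, implies_true,
    and_true, and_imp, Lit.map] at h'
  obtain ⟨h1, h2, h3, h4, h5, h6, h7, h8, h9, h10, h11, h12, h13, h14, h15, h16⟩ := h'
  constructor
  · exact fun {x y z} => h1 [x, y, z]
  · exact fun {x y x' y'} => h2 [x, y, x', y']
  · exact fun {a b c a' c'} => h3 [a, b, c, a', c']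
  · exact fun {a b c z c'} => h4 [a, b, c, z, c']
  · exact fun {a b c b' c'} => h5 [a, b, c, b', c']
  · exact fun {a c a' z c'} => h6 [a, c, a', z, c']
  · exact fun {c x x' z} => h7 [c, x, x', z]
  · exact fun {c x y} => h8 [c, x, y]
  · exact fun {c a b x} => h9 [c, a, b, x]
  · exact fun {c a b x} => h10 [c, a, b, x]
  · exact fun {c f g x a b y} => h11 [c, f, g, x, a, b, y]
  · exact fun {c f g x a y} => h12 [c, f, g, x, a, y]
  · exact fun {c f g a z x y} => h13 [c, f, g, a, z, x, y]
  · exact fun {c f g a n x i n' p q y x'} => h14 [c, f, g, a, n, x, i, n', p, q, y, x']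
  · exact fun {c f a m x z} => h15 [c, f, a, m, x, z]
  · exact fun {c f a m x v w m' x' y} => h16 [c, f, a, m, x, v, w, m', x', y]

/-- The literals that describe the syntax tree of a program. -/
def codeLits : Code → List Lit
  | .zero => [.codeZero (encode Code.zero)]
  | .succ => [.codeSucc (encode Code.succ)]
  | .left => [.codeLeft (encode Code.left)]
  | .right => [.codeRight (encode Code.right)]
  | .pair f g => .codePair (encode (Code.pair f g)) (encode f) (encode g) ::
      (codeLits f ++ codeLits g)
  | .comp f g => .codeComp (encode (Code.comp f g)) (encode f) (encode g) ::
      (codeLits f ++ codeLits g)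
  | .prec f g => .codePrec (encode (Code.prec f g)) (encode f) (encode g) ::
      (codeLits f ++ codeLits g)
  | .rfind' f => .codeRfind (encode (Code.rfind' f)) (encode f) :: codeLits f

theorem isTrue_of_mem_codeLits {c : Code} {l : Lit} (h : l ∈ codeLits c) :
    l.1 < 14 ∧ l.IsTrue := by
  induction c with
  | zero | succ | left | right =>
    obtain rfl := List.mem_singleton.1 h
    exact ⟨by decide, Denumerable.ofNat_encode _⟩
  | pair f g hf hg | comp f g hf hg | prec f g hf hg =>
    rcases List.mem_cons.1 h with rfl | h
    · exact ⟨by simp, by simp [Lit.IsTrue]⟩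
    · exact (List.mem_append.1 h).elim hf hg
  | rfind' f hf =>
    rcases List.mem_cons.1 h with rfl | h
    · exact ⟨by simp, by simp [Lit.IsTrue]⟩
    · exact hf h

namespace ClosedUnderRules

variable {Φ : Lit → Prop} (h : ClosedUnderRules Φ) (hz : Φ (.zero 0))
  (hs : ∀ i, Φ (.succ i (i + 1))) (hp : Φ (.pair 0 0 0))

include h hz hs

theorem lt_of_lt {i j : ℕ} (hij : i < j) : Φ (.lt i j) := by
  induction i generalizing j with
  | zero =>
    obtain ⟨j, rfl⟩ := Nat.exists_eq_succ_of_ne_zero hij.ne'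
    exact h.lt_zero hz (hs j)
  | succ i ih =>
    obtain ⟨j, rfl⟩ := Nat.exists_eq_succ_of_ne_zero (Nat.ne_zero_of_lt hij)
    exact h.lt_succ (ih (Nat.lt_of_succ_lt_succ hij)) (hs i) (hs j)

include hp

/-- Induction on the code `m`: the pair with code `m` determines its successor in the shell order,
and the four cases are the four pairing rules. -/
theorem pair_of_eq {m a b : ℕ} (hm : Nat.pair a b = m) : Φ (.pair a b m) := by
  induction m generalizing a b with
  | zero =>
    obtain ⟨rfl, rfl⟩ : a = 0 ∧ b = 0 := Nat.pair_eq_pair.1 (hm.trans (by decide))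
    exact hp
  | succ m ih =>
    obtain ⟨c, d, hcd⟩ : ∃ c d, Nat.pair c d = m := ⟨_, _, Nat.pair_unpair m⟩
    have key : ∀ {a' b'}, Nat.pair a' b' = Nat.pair c d + 1 → a' = a ∧ b' = b := fun e =>
      Nat.pair_eq_pair.1 (by rw [e, hcd, hm])
    rcases lt_trichotomy (c + 1) d with hlt | rfl | hgt
    · obtain ⟨rfl, rfl⟩ := key (pair_succ_of_succ_lt hlt)
      exact h.pair_left (ih hcd) (hs c) (h.lt_of_lt hz hs hlt) (hs m)
    · obtain ⟨rfl, rfl⟩ := key (pair_succ_zero c)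
      exact h.pair_left_end (ih hcd) (hs c) hz (hs m)
    · rcases (Nat.lt_succ_iff.1 hgt).lt_or_eq with hlt | rfl
      · obtain ⟨rfl, rfl⟩ := key (pair_succ_right_of_lt hlt)
        exact h.pair_right (ih hcd) (h.lt_of_lt hz hs hlt) (hs d) (hs m)
      · obtain ⟨rfl, rfl⟩ := key (pair_zero_succ d)
        exact h.pair_right_end (ih hcd) (hs d) hz (hs m)

/-- Every value of a program can be derived from the description of the program. -/
theorem eval_of_mem_eval {c : Code} (hc : ∀ l ∈ codeLits c, Φ l) {x y : ℕ} (hy : y ∈ c.eval x) :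
    Φ (.eval (encode c) x y) := by
  have hpair : ∀ a b, Φ (.pair a b (Nat.pair a b)) := fun a b => h.pair_of_eq hz hs hp rfl
  induction c generalizing x y with
  | zero =>
    obtain rfl : y = 0 := by simpa [Code.eval, pure, PFun.pure] using hy
    exact h.eval_zero (hc _ (by simp [codeLits])) (hs x) hz
  | succ =>
    obtain rfl : y = x + 1 := by simpa [Code.eval] using hy
    exact h.eval_succ (hc _ (by simp [codeLits])) (hs x)
  | left =>
    obtain rfl : y = x.unpair.1 := by simpa [Code.eval] using hy
    exact h.eval_left (hc _ (by simp [codeLits])) (h.pair_of_eq hz hs hp (Nat.pair_unpair x))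
  | right =>
    obtain rfl : y = x.unpair.2 := by simpa [Code.eval] using hy
    exact h.eval_right (hc _ (by simp [codeLits])) (h.pair_of_eq hz hs hp (Nat.pair_unpair x))
  | pair f g hf hg =>
    simp only [codeLits, List.forall_mem_cons, List.forall_mem_append] at hc
    obtain ⟨a, ha, b, hb, rfl⟩ := mem_eval_pair_iff.1 hy
    exact h.eval_pair hc.1 (hf hc.2.1 ha) (hg hc.2.2 hb) (hpair a b)
  | comp f g hf hg =>
    simp only [codeLits, List.forall_mem_cons, List.forall_mem_append] at hc
    obtain ⟨a, ha, hb⟩ := mem_eval_comp_iff.1 hy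
    exact h.eval_comp hc.1 (hg hc.2.2 ha) (hf hc.2.1 hb)
  | prec f g hf hg =>
    simp only [codeLits, List.forall_mem_cons, List.forall_mem_append] at hc
    obtain ⟨a, n, rfl⟩ : ∃ a n, x = Nat.pair a n := ⟨_, _, (Nat.pair_unpair x).symm⟩
    induction n generalizing y with
    | zero =>
      rw [Code.eval_prec_zero] at hy
      exact h.eval_prec_zero hc.1 (hpair a 0) hz (hf hc.2.1 hy)
    | succ n ih =>
      obtain ⟨i, hi, hy⟩ := mem_eval_prec_succ_iff.1 hy
      exact h.eval_prec_succ hc.1 (hpair _ _) (ih hi) (hs n) (hpair n i) (hpair _ _)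
        (hg hc.2.2 hy) (hpair _ _)
  | rfind' f hf =>
    simp only [codeLits, List.forall_mem_cons] at hc
    obtain ⟨a, m, rfl⟩ : ∃ a m, x = Nat.pair a m := ⟨_, _, (Nat.pair_unpair x).symm⟩
    obtain ⟨k, rfl, h0, hk⟩ := mem_eval_rfind'_iff.1 hy
    clear hy
    -- Induction on the number of failed trials, while the starting point `m` moves up by one.
    induction k generalizing m with
    | zero =>
      rw [Nat.zero_add] at h0 ⊢
      exact h.eval_rfind_zero hc.1 (hpair _ _) (hf hc.2 h0) hz
    | succ k ih =>
      obtain ⟨v, hv⟩ := hk 0 k.succ_pos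
      rw [Nat.zero_add] at hv
      have e : k + 1 + m = k + (m + 1) := by ring
      rw [e] at h0 ⊢
      refine h.eval_rfind_succ hc.1 (hpair _ _) (hf hc.2 hv) (hs v) (hs m) (hpair _ _)
        (ih (m + 1) h0 fun j hj => ?_)
      obtain ⟨w, hw⟩ := hk (j + 1) (Nat.succ_lt_succ hj)
      exact ⟨w, by rwa [show j + (m + 1) = j + 1 + m by ring]⟩

end ClosedUnderRules

end DataReadiness

namespace DataReadiness

/-! ### The inputs -/

open Nat.Partrec (Code)
open Encodable (encode)

/-- A program that uses every constructor. -/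
def sampleCode : Code :=
  .pair (.comp .left .right) (.prec .succ (.rfind' .zero))

/-- The literals that hold in the instance for the program `u`, whatever its argument.  Every
predicate but the input occurs among them, so that no relation is empty. -/
def baseLits (u : Code) : List Lit :=
  [.zero 0, .succ 0 1, .lt 0 1, .pair 0 0 0, .eval 0 0 0] ++ (codeLits sampleCode ++ codeLits u)

/-- A bound for the values in the base literals. -/
def baseBound (u : Code) : ℕ :=
  -- The `+ 1` guarantees a first link in the chain, from which the successor rule can continue.
  ((baseLits u).map fun l => l.args.sum).sum + 1

/-- The facts in the written copy only keep those relations nonempty. The initial chain reaches past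
`n`, `encode u` and all values of base literals, so these keep their names when the chain is
prolonged. -/
def inputFacts (u : Code) (n : ℕ) : List Fact :=
  (baseLits u).flatMap (fun l => [l.fact 0, l.fact 1]) ++
    [Lit.fact 0 (.input (encode u) n), Lit.fact 1 (.input (encode u) n)] ++
    (List.range (n + (encode u + baseBound u))).map fun i => Lit.fact 0 (.succ i (i + 1))

def readinessProcs : List Procedure := readinessTgds.map tgdProcedure

def readinessInput (u : Code) (n : ℕ) : ReadinessInput :=
  ⟨ternSchema, inputFacts u n, readinessProcs, [.tgd targetTgd]⟩

/-- The instance of the input. -/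
def initialInstance (u : Code) (n : ℕ) : Instance ternSchema :=
  instanceOf ternSchema (inputFacts u n)

theorem isTrue_of_mem_baseLits {u : Code} {l : Lit} (h : l ∈ baseLits u) :
    l.1 < 14 ∧ l.IsTrue := by
  rcases List.mem_append.1 h with h | h
  · simp only [List.mem_cons, List.not_mem_nil, or_false] at h
    rcases h with rfl | rfl | rfl | rfl | rfl <;> refine ⟨by simp, ?_⟩
    · rfl
    · rfl
    · exact Nat.zero_lt_one
    · rfl
    · have : Denumerable.ofNat Code 0 = .zero := Denumerable.ofNat_encode Code.zero
      simp [Lit.IsTrue, this, Code.eval, pure, PFun.pure]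
  · exact (List.mem_append.1 h).elim isTrue_of_mem_codeLits isTrue_of_mem_codeLits

theorem exists_mem_baseLits (u : Code) {k : ℕ} (hk : k < 14) (hk5 : k ≠ 5) :
    ∃ l ∈ baseLits u, l.1 = k := by
  have key : ∀ k < 14, k ≠ 5 → k ∈ (([.zero 0, .succ 0 1, .lt 0 1, .pair 0 0 0, .eval 0 0 0] ++
      codeLits sampleCode : List Lit).map Prod.fst) := by
    simp only [sampleCode, codeLits]
    simp only [List.cons_append, List.nil_append, List.map_cons, List.map_nil]
    decide
  obtain ⟨l, hl, rfl⟩ := List.mem_map.1 (key k hk hk5)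
  exact ⟨l, by rw [baseLits, ← List.append_assoc]; exact List.mem_append_left _ hl, rfl⟩

theorem le_baseBound {u : Code} {l : Lit} (hl : l ∈ baseLits u) {x : ℕ} (hx : x ∈ l.args) :
    x ≤ baseBound u :=
  calc x ≤ l.args.sum := List.le_sum_of_mem hx
    _ ≤ ((baseLits u).map fun l => l.args.sum).sum :=
      List.le_sum_of_mem (List.mem_map_of_mem (f := fun l : Lit => l.args.sum) hl)
    _ ≤ baseBound u := Nat.le_succ _

theorem Lit.ext_of_fact {b b' : ℕ} (hb : b < 2) (hb' : b' < 2) {l l' : Lit}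
    (hrel : (l.fact b).rel = 2 * l'.1 + b')
    (ht : (l.fact b).tuple = triple l'.2.1 l'.2.2.1 l'.2.2.2) : b = b' ∧ l = l' := by
  obtain ⟨h1, h2, h3⟩ := triple_inj.1 (show triple _ _ _ = _ from ht)
  have h : 2 * l.1 + b = 2 * l'.1 + b' := hrel
  have h0 : l.1 = l'.1 := by omega
  exact ⟨by omega, Prod.ext h0 (Prod.ext h1 (Prod.ext h2 h3))⟩

theorem holdsIn_initialInstance_iff {u : Code} {n b : ℕ} (hb : b < 2) {l : Lit} :
    l.HoldsIn (initialInstance u n) b ↔ l ∈ baseLits u ∨ l = .input (encode u) n ∨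
      (b = 0 ∧ ∃ i < n + (encode u + baseBound u), l = .succ i (i + 1)) := by
  constructor
  · rintro ⟨-, f, hf, hrel, ht⟩
    simp only [inputFacts, List.mem_append, List.mem_flatMap, List.mem_map, List.mem_cons,
      List.not_mem_nil, or_false, List.mem_range] at hf
    rcases hf with (⟨l', hl', rfl | rfl⟩ | rfl | rfl) | ⟨i, hi, rfl⟩
    · obtain ⟨-, rfl⟩ := Lit.ext_of_fact (by omega) hb hrel ht
      exact Or.inl hl'
    · obtain ⟨-, rfl⟩ := Lit.ext_of_fact (by omega) hb hrel ht
      exact Or.inl hl'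
    · exact Or.inr (Or.inl (Lit.ext_of_fact (by omega) hb hrel ht).2.symm)
    · exact Or.inr (Or.inl (Lit.ext_of_fact (by omega) hb hrel ht).2.symm)
    · obtain ⟨h1, h2⟩ := Lit.ext_of_fact (by omega) hb hrel ht
      exact Or.inr (Or.inr ⟨h1.symm, i, hi, h2.symm⟩)
  · intro h
    have hl : l.1 < 14 := by
      rcases h with h | rfl | ⟨-, i, -, rfl⟩
      · exact (isTrue_of_mem_baseLits h).1
      · simp
      · simp
    refine ⟨ternSchema_isTuple_iff.2 ⟨show 2 * l.1 + b < 28 by omega, _, _, _, rfl⟩, l.fact b, ?_,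
      rfl, rfl⟩
    simp only [inputFacts, List.mem_append, List.mem_flatMap, List.mem_map, List.mem_cons,
      List.not_mem_nil, or_false, List.mem_range]
    obtain rfl | rfl : b = 0 ∨ b = 1 := by omega
    · rcases h with h | rfl | ⟨-, i, hi, rfl⟩
      · exact Or.inl (Or.inl ⟨l, h, Or.inl rfl⟩)
      · exact Or.inl (Or.inr (Or.inl rfl))
      · exact Or.inr ⟨i, hi, rfl⟩
    · rcases h with h | rfl | ⟨h, -⟩
      · exact Or.inl (Or.inl ⟨l, h, Or.inr rfl⟩)
      · exact Or.inl (Or.inr (Or.inr rfl))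
      · omega

theorem exists_holdsIn_of_mem_rel {J : Instance ternSchema} {R : RelName} {t : Tuple}
    (ht : t ∈ J.rel R) : ∃ b < 2, ∃ l : Lit, l.1 < 14 ∧ R = 2 * l.1 + b ∧
      t = triple l.2.1 l.2.2.1 l.2.2.2 ∧ l.HoldsIn J b := by
  obtain ⟨hR, x, y, z, rfl⟩ := ternSchema_isTuple_iff.1 (J.isTuple R t ht)
  have hR' : (2 * (R / 2 : ℕ) + (R % 2 : ℕ) : ℕ) = R := Nat.div_add_mod R 2
  refine ⟨(R % 2 : ℕ), Nat.mod_lt _ (by omega), ((R / 2 : ℕ), x, y, z),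
    Nat.div_lt_of_lt_mul hR, hR'.symm, rfl, ?_⟩
  rw [Lit.HoldsIn]
  simpa only [hR'] using ht

theorem initialInstance_subset_standardModel (u : Code) (n : ℕ) (R : RelName) :
    (initialInstance u n).rel R ⊆ standardModel.rel R := by
  intro t ht
  obtain ⟨b, hb, l, hl, rfl, rfl, h⟩ := exists_holdsIn_of_mem_rel ht
  refine (holdsIn_standardModel_iff hb).2 ⟨hl, ?_⟩
  rcases (holdsIn_initialInstance_iff hb).1 h with h | rfl | ⟨-, i, -, rfl⟩
  · exact (isTrue_of_mem_baseLits h).2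
  · trivial
  · rfl

/-! ### Readiness implies halting, and the target fails initially -/

theorem holdsIn_of_targetTgd_holds {u : Code} {n : ℕ} {J : Instance ternSchema}
    (hJ : (Lit.input (encode u) n).HoldsIn J 0) (h : targetTgd.Holds J) :
    ∃ y, (Lit.eval (encode u) n y).HoldsIn J 0 := by
  obtain ⟨τ, hτ, hsat⟩ := h (fun v => [encode u, n].getD v 0) (by
    intro a ha
    obtain rfl := List.mem_singleton.1 ha
    rw [Lit.atom_sat_iff]
    exact hJ)
  have h0 := hτ _ (List.mem_singleton_self _) 0 (Lit.mem_vars_atom.2 (by simp [Lit.args]))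
  have h1 := hτ _ (List.mem_singleton_self _) 1 (Lit.mem_vars_atom.2 (by simp [Lit.args]))
  have h2 := hsat _ (List.mem_singleton_self _)
  rw [Lit.atom_sat_iff] at h2
  refine ⟨τ 2, ?_⟩
  simpa [Lit.map, h0, h1] using h2

/-- The outcome inside the standard model still contains the input fact, so the target yields a
value of `eval` which is true there. -/
theorem dom_of_ready {u : Code} {n : ℕ} (h : (readinessInput u n).Ready) : (u.eval n).Dom := by
  obtain ⟨Ps, hPs, hout⟩ := h
  obtain ⟨J, hJ, hIJ, hJM⟩ := exists_seqOutcomes_below readinessTgds_compatible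
    readinessTgds_standardModel Ps hPs _ (initialInstance_subset_standardModel u n)
  obtain ⟨y, hy⟩ := holdsIn_of_targetTgd_holds (u := u) (n := n)
    (((holdsIn_initialInstance_iff (by omega)).2 (Or.inr (Or.inl rfl))).mono hIJ)
    (hout J hJ _ (List.mem_singleton_self _)).2
  have := ((holdsIn_standardModel_iff (by omega)).1 (hy.mono hJM)).2
  simp only [Lit.IsTrue, Denumerable.ofNat_encode] at this
  exact Part.dom_iff_mem.2 ⟨y, this⟩

theorem six_le_of_mem_codeLits {c : Code} {l : Lit} (h : l ∈ codeLits c) : 6 ≤ l.1 := by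
  induction c with
  | zero | succ | left | right =>
    obtain rfl := List.mem_singleton.1 h
    simp
  | pair f g hf hg | comp f g hf hg | prec f g hf hg =>
    rcases List.mem_cons.1 h with rfl | h
    · simp
    · exact (List.mem_append.1 h).elim hf hg
  | rfind' f hf =>
    rcases List.mem_cons.1 h with rfl | h
    · simp
    · exact hf h

/-- The only initial `eval` fact is `eval 0 0 0`, and the code 0 belongs to `Code.zero`. -/
theorem targetTgd_not_holds {u : Code} (hu : u ≠ .zero) (n : ℕ) :
    ¬ targetTgd.Holds (initialInstance u n) := by
  intro h
  obtain ⟨y, hy⟩ := holdsIn_of_targetTgd_holds (u := u) (n := n)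
    ((holdsIn_initialInstance_iff (by omega)).2 (Or.inr (Or.inl rfl))) h
  rcases (holdsIn_initialInstance_iff (by omega)).1 hy with h | h | ⟨-, i, -, h⟩
  · have hc : ∀ c, Lit.eval (encode u) n y ∉ codeLits c := fun c hc =>
      absurd (six_le_of_mem_codeLits hc) (by simp)
    simp only [baseLits, List.mem_append, hc, or_false, List.mem_cons, List.not_mem_nil,
      Prod.mk.injEq] at h
    have h0 : encode u = encode Code.zero := by
      rw [show encode Code.zero = 0 from rfl]
      omega
    exact hu (Encodable.encode_injective h0)
  · simp at h
  · simp at h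

/-! ### Derivations are forced by sequences of procedures -/

/-- The instance has a chain of `N` successors, given by `ν`, that interprets the base literals, and
its input consists of `u` and `n`. -/
structure Interprets (u : Code) (n N : ℕ) (ν : ℕ → ℕ) (J : Instance ternSchema) : Prop where
  nonempty : ∀ R < 28, (J.rel R).Nonempty
  base : ∀ l ∈ baseLits u, (l.map ν).HoldsIn J 0
  -- The values `ν i` may coincide, since outcomes choose the witnesses for successors.
  chain : ∀ i < N, ((Lit.succ i (i + 1)).map ν).HoldsIn J 0
  input : ∀ l : Lit, l.1 = 5 → l.HoldsIn J 0 → l = .input (encode u) n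
  map_code : ν (encode u) = encode u
  map_arg : ν n = n

theorem Interprets.anti {u : Code} {n N N' : ℕ} {ν : ℕ → ℕ} {J : Instance ternSchema}
    (h : Interprets u n N ν J) (hN : N' ≤ N) : Interprets u n N' ν J :=
  { h with chain := fun i hi => h.chain i (hi.trans_le hN) }

/-- Relations only grow, which keeps them nonempty for the next step, and the input relation stays
the same. -/
theorem Interprets.preserved {u : Code} {n N : ℕ} {ν : ℕ → ℕ} {Ps : List Procedure}
    (hPs : ∀ P ∈ Ps, P ∈ readinessProcs) {J K : Instance ternSchema} (h : Interprets u n N ν J)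
    (hK : K ∈ seqOutcomes Ps J) : Interprets u n N ν K ∧ ∀ R, J.rel R ⊆ K.rel R := by
  induction Ps generalizing J with
  | nil =>
    obtain rfl : K = J := hK
    exact ⟨h, fun _ => subset_rfl⟩
  | cons P Ps ih =>
    obtain ⟨L, hL, hK⟩ := hK
    obtain ⟨d, hd, rfl⟩ := List.mem_map.1 (hPs P (by simp))
    have hne : ∀ R ∈ ternSchema.rels, (J.rel R).Nonempty := fun R hR => h.nonempty R (by
      simpa [Schema.rels, ternSchema, Function.comp_def] using hR)
    have hJL := tgdProcedure_outcome_subset hne hL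
    have hin := tgdProcedure_outcome_rel_eq hne hL (readinessTgds_not_mentions_input d hd)
    have hL' : Interprets u n N ν L :=
      { nonempty := fun R hR => (h.nonempty R hR).mono (hJL R)
        base := fun l hl => (h.base l hl).mono hJL
        chain := fun i hi => (h.chain i hi).mono hJL
        input := fun l hl hl' => h.input l hl (by
          rw [Lit.HoldsIn, hl] at hl' ⊢
          exact hin ▸ hl')
        map_code := h.map_code
        map_arg := h.map_arg }
    obtain ⟨hK', hLK⟩ := ih (fun P hP => hPs P (by simp [hP])) hL' hK
    exact ⟨hK', fun R => (hJL R).trans (hLK R)⟩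

theorem initialInstance_interprets (u : Code) (n : ℕ) :
    Interprets u n (n + (encode u + baseBound u)) id (initialInstance u n) where
  nonempty := by
    intro R hR
    have hb : (R % 2 : ℕ) < 2 := Nat.mod_lt _ (by omega)
    have hk : (R / 2 : ℕ) < 14 := Nat.div_lt_of_lt_mul hR
    have hR' : (2 * (R / 2 : ℕ) + (R % 2 : ℕ) : ℕ) = R := Nat.div_add_mod R 2
    suffices ∃ l : Lit, l.1 = (R / 2 : ℕ) ∧ l.HoldsIn (initialInstance u n) (R % 2 : ℕ) by
      obtain ⟨l, hl, h⟩ := this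
      rw [Lit.HoldsIn, hl] at h
      simp only [hR'] at h
      exact ⟨_, h⟩
    by_cases h5 : (R / 2 : ℕ) = 5
    · exact ⟨_, h5.symm, (holdsIn_initialInstance_iff hb).2 (Or.inr (Or.inl rfl))⟩
    · obtain ⟨l, hl, h⟩ := exists_mem_baseLits u hk h5
      exact ⟨l, h, (holdsIn_initialInstance_iff hb).2 (Or.inl hl)⟩
  base l hl := (holdsIn_initialInstance_iff (by omega)).2 (Or.inl hl)
  chain i hi := (holdsIn_initialInstance_iff (by omega)).2 (Or.inr (Or.inr ⟨rfl, i, hi, rfl⟩))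
  input l hl h := by
    rcases (holdsIn_initialInstance_iff (by omega)).1 h with h | h | ⟨-, i, -, h⟩
    · exfalso
      rcases List.mem_append.1 h with h | h
      · simp only [List.mem_cons, List.not_mem_nil, or_false] at h
        rcases h with rfl | rfl | rfl | rfl | rfl <;> simp at hl
      · have : 6 ≤ l.1 :=
          (List.mem_append.1 h).elim six_le_of_mem_codeLits six_le_of_mem_codeLits
        omega
    · exact h
    · rw [h] at hl
      simp at hl
  map_code := rfl
  map_arg := rfl

end DataReadiness

namespace DataReadiness

open Nat.Partrec (Code)
open Encodable (encode)

theorem Lit.HoldsIn.of_copyTgd {J : Instance ternSchema} {l : Lit} (h : (copyTgd l.1).Holds J)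
    (hl : l.HoldsIn J 1) : l.HoldsIn J 0 := by
  obtain ⟨k, x, y, z⟩ := l
  obtain ⟨τ, hτ, hsat⟩ := h (fun v => [x, y, z].getD v 0) (by
    intro a ha
    obtain rfl := List.mem_singleton.1 ha
    rw [Lit.atom_sat_iff]
    exact hl)
  have hv : ∀ v ∈ [0, 1, 2], τ v = [x, y, z].getD v 0 := fun v hv =>
    hτ _ (List.mem_singleton_self _) v (Lit.mem_vars_atom.2 hv)
  have h3 := hsat _ (List.mem_singleton_self _)
  rw [Lit.atom_sat_iff] at h3
  simpa [Lit.map, hv] using h3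

theorem Rule.exists_head_holdsIn {J : Instance ternSchema} {r : Rule} (h : r.tgd.Holds J)
    {τ : Var → Val} (hb : ∀ l ∈ r.body, (l.map τ).HoldsIn J 0) :
    ∃ τ' : Var → Val, (∀ l ∈ r.body, ∀ v ∈ l.args, τ' v = τ v) ∧ (r.head.map τ').HoldsIn J 1 := by
  obtain ⟨τ', hτ, hsat⟩ := h τ (by
    intro a ha
    obtain ⟨l, hl, rfl⟩ := List.mem_map.1 ha
    exact Lit.atom_sat_iff.2 (hb l hl))
  exact ⟨τ', fun l hl v hv => hτ _ (List.mem_map_of_mem hl) v (Lit.mem_vars_atom.2 hv),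
    Lit.atom_sat_iff.1 (hsat _ (List.mem_singleton_self _))⟩

theorem Lit.map_congr {l : Lit} {σ τ : ℕ → ℕ} (h : ∀ v ∈ l.args, σ v = τ v) :
    l.map σ = l.map τ := by
  simp only [Lit.args, List.forall_mem_cons] at h
  simp [Lit.map, h]

/-- The procedures that apply a rule and copy its result. -/
def ruleProcs (r : Rule) : List Procedure :=
  [tgdProcedure r.tgd, tgdProcedure (copyTgd r.head.1)]

theorem ruleProcs_subset {r : Rule} (hr : r = succRule ∨ r ∈ datalogRules) :
    ∀ P ∈ ruleProcs r, P ∈ readinessProcs := by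
  have h1 : r.tgd ∈ readinessTgds := by
    rcases hr with rfl | hr
    · exact List.mem_cons_self
    · exact List.mem_cons_of_mem _ (List.mem_append_left _ (List.mem_map_of_mem hr))
  have h2 : r.head.1 ∈ derivedPreds := by
    rcases hr with rfl | hr
    · decide
    · exact (datalogRules_preds r hr).2
  have h3 : copyTgd r.head.1 ∈ readinessTgds :=
    List.mem_cons_of_mem _ (List.mem_append_right _ (List.mem_map_of_mem h2))
  intro P hP
  simp only [ruleProcs, List.mem_cons, List.not_mem_nil, or_false] at hP
  rcases hP with rfl | rfl
  · exact List.mem_map_of_mem h1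
  · exact List.mem_map_of_mem h3

/-- The first procedure forces the head into the written copy, the second forces it into the read
copy. Agreement of `τ'` with `τ` is limited to body variables because the head may have an
existential one. -/
theorem Interprets.apply_rule {u : Code} {n N : ℕ} {ν : ℕ → ℕ} {J K : Instance ternSchema}
    (h : Interprets u n N ν J) {r : Rule} (hr : r = succRule ∨ r ∈ datalogRules)
    (hK : K ∈ seqOutcomes (ruleProcs r) J) {τ : Var → Val}
    (hb : ∀ l ∈ r.body, (l.map τ).HoldsIn J 0) :
    ∃ τ' : Var → Val, (∀ l ∈ r.body, ∀ v ∈ l.args, τ' v = τ v) ∧ (r.head.map τ').HoldsIn K 0 := by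
  have hP := ruleProcs_subset hr
  obtain ⟨L, hL, K', hK', hKK'⟩ := hK
  obtain rfl : K = K' := hKK'
  have hL' : L ∈ seqOutcomes [tgdProcedure r.tgd] J := ⟨L, hL, rfl⟩
  have hK'' : K ∈ seqOutcomes [tgdProcedure (copyTgd r.head.1)] L := ⟨K, hK', rfl⟩
  obtain ⟨hLint, hJL⟩ := h.preserved (fun P hP' => hP P (by
    rw [List.mem_singleton.1 hP']; simp [ruleProcs])) hL'
  obtain ⟨-, hLK⟩ := hLint.preserved (fun P hP' => hP P (by
    rw [List.mem_singleton.1 hP']; simp [ruleProcs])) hK''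
  obtain ⟨τ', hτ', hhead⟩ := Rule.exists_head_holdsIn (tgdProcedure_outcome_holds hL)
    fun l hl => (hb l hl).mono hJL
  exact ⟨τ', hτ', Lit.HoldsIn.of_copyTgd (tgdProcedure_outcome_holds hK') (hhead.mono hLK)⟩

/-- Each round applies the successor rule to the last link and takes the witness chosen by the
outcome as the next value of `ν`. Thus `ν` depends on the outcome, the sequence of procedures does
not. -/
theorem exists_interprets (u : Code) (n m : ℕ) :
    ∃ Ps : List Procedure, (∀ P ∈ Ps, P ∈ readinessProcs) ∧
      ∀ J ∈ seqOutcomes Ps (initialInstance u n),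
        ∃ ν, Interprets u n (n + (encode u + baseBound u) + m) ν J := by
  induction m with
  | zero =>
    refine ⟨[], by simp, fun J hJ => ⟨id, ?_⟩⟩
    obtain rfl : J = _ := hJ
    exact initialInstance_interprets u n
  | succ m ih =>
    obtain ⟨Ps, hPs, hout⟩ := ih
    refine ⟨Ps ++ ruleProcs succRule, ?_, fun K hK => ?_⟩
    · rw [List.forall_mem_append]
      exact ⟨hPs, ruleProcs_subset (Or.inl rfl)⟩
    obtain ⟨J, hJ, hK⟩ := (seqOutcomes_append _ _ _ _).1 hK
    obtain ⟨ν, hν⟩ := hout J hJ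
    have hν' := (hν.preserved (ruleProcs_subset (Or.inl rfl)) hK).1
    have hbound : 0 < baseBound u := Nat.succ_pos _
    obtain ⟨N, hN⟩ : ∃ N, n + (encode u + baseBound u) + m = N + 1 :=
      Nat.exists_eq_succ_of_ne_zero (by omega)
    rw [hN] at hν
    obtain ⟨τ, hτ, hhead⟩ := hν.apply_rule (Or.inl rfl) hK (τ := fun v => ν (N + v)) (by
      intro l hl
      obtain rfl := List.mem_singleton.1 hl
      exact hν.chain N (by omega))
    have h1 : τ 1 = ν (N + 1) := hτ _ (List.mem_singleton_self _) 1 (by simp [Lit.args])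
    -- The new index `N + 2` lies beyond the old chain, hence beyond `n`, `encode u` and all
    -- arguments of base literals.
    have hne : ∀ x ≤ N + 1, Function.update ν (N + 2) (τ 2) x = ν x := fun x hx =>
      Function.update_of_ne (by omega) _ _
    refine ⟨Function.update ν (N + 2) (τ 2), ?_⟩
    rw [← add_assoc, hN]
    rw [hN] at hν'
    exact
      { nonempty := hν'.nonempty
        base := fun l hl => by
          rw [Lit.map_congr fun x hx => hne x (by have := le_baseBound hl hx; omega)]
          exact hν'.base l hl
        chain := fun i hi => by
          rcases (Nat.lt_succ_iff.1 hi).lt_or_eq with hi | rfl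
          · rw [Lit.map_congr fun x hx => hne x (by
              simp only [Lit.args, List.mem_cons, List.not_mem_nil, or_false] at hx; omega)]
            exact hν'.chain i hi
          · simpa [Lit.map, hne, succRule, h1] using hhead
        input := hν'.input
        map_code := by rw [hne _ (by omega), hν'.map_code]
        map_arg := by rw [hne _ (by omega), hν'.map_arg] }

/-- Some sequence of procedures produces all the literals, interpreted in a long enough chain. -/
def AllForced (u : Code) (n : ℕ) (ls : List Lit) : Prop :=
  ∃ N, ∃ Ps : List Procedure, (∀ P ∈ Ps, P ∈ readinessProcs) ∧
    ∀ ν J, Interprets u n N ν J → ∀ K ∈ seqOutcomes Ps J, ∀ l ∈ ls, (l.map ν).HoldsIn K 0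

def Forced (u : Code) (n : ℕ) (l : Lit) : Prop := AllForced u n [l]

/-- Concatenate the sequences and take the longest chain: later procedures destroy neither the chain
nor the literals already obtained. -/
theorem allForced_of_forall {u : Code} {n : ℕ} {ls : List Lit} (h : ∀ l ∈ ls, Forced u n l) :
    AllForced u n ls := by
  induction ls with
  | nil => exact ⟨0, [], by simp, by simp⟩
  | cons l ls ih =>
    rw [List.forall_mem_cons] at h
    obtain ⟨N, Ps, hPs, hN⟩ := h.1
    obtain ⟨M, Qs, hQs, hM⟩ := ih h.2
    refine ⟨max N M, Ps ++ Qs, List.forall_mem_append.2 ⟨hPs, hQs⟩, fun ν J hJ K hK => ?_⟩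
    obtain ⟨L, hL, hK⟩ := (seqOutcomes_append _ _ _ _).1 hK
    have hLint := (hJ.preserved hPs hL).1
    refine List.forall_mem_cons.2 ⟨?_, hM ν L (hLint.anti (le_max_right _ _)) K hK⟩
    exact (hN ν J (hJ.anti (le_max_left _ _)) L hL l (List.mem_singleton_self l)).mono
      (hLint.preserved hQs hK).2

/-- Force all body literals, then run the rule under the assignment `ν ∘ σ`; every head variable
occurs in the body, so the outcome has no choice for the head. -/
theorem forced_closedUnderRules (u : Code) (n : ℕ) : ClosedUnderRules (Forced u n) := by
  refine closedUnderRules_of_datalogRules fun r hr σ hb => ?_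
  obtain ⟨N, Ps, hPs, hN⟩ := allForced_of_forall (ls := r.body.map (Lit.map σ)) 
    (List.forall_mem_map.2 hb)
  refine ⟨N, Ps ++ ruleProcs r,
    List.forall_mem_append.2 ⟨hPs, ruleProcs_subset (Or.inr hr)⟩, fun ν J hJ K hK l hl => ?_⟩
  obtain rfl := List.mem_singleton.1 hl
  obtain ⟨L, hL, hK⟩ := (seqOutcomes_append _ _ _ _).1 hK
  obtain ⟨τ, hτ, hhead⟩ := (hJ.preserved hPs hL).1.apply_rule (Or.inr hr) hK (τ := ν ∘ σ)
    fun l hl => hN ν J hJ L hL _ (List.mem_map_of_mem hl)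
  have : r.head.map τ = (r.head.map σ).map ν := Lit.map_congr (τ := ν ∘ σ) fun v hv => by
    obtain ⟨l, hl, hv⟩ := datalogRules_vars r hr v hv
    exact hτ l hl v hv
  exact this ▸ hhead

theorem forced_of_mem_baseLits {u : Code} {n : ℕ} {l : Lit} (hl : l ∈ baseLits u) :
    Forced u n l := by
  refine ⟨0, [], by simp, fun ν J hJ K hK l' hl' => ?_⟩
  obtain rfl : K = J := hK
  obtain rfl := List.mem_singleton.1 hl'
  exact hJ.base l' hl

theorem forced_succ (u : Code) (n i : ℕ) : Forced u n (.succ i (i + 1)) := by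
  refine ⟨i + 1, [], by simp, fun ν J hJ K hK l hl => ?_⟩
  obtain rfl : K = J := hK
  obtain rfl := List.mem_singleton.1 hl
  exact hJ.chain i i.lt_succ_self

theorem Interprets.targetTgd_holds {u : Code} {n N y : ℕ} {ν : ℕ → ℕ} {J : Instance ternSchema}
    (h : Interprets u n N ν J) (hy : ((Lit.eval (encode u) n y).map ν).HoldsIn J 0) :
    targetTgd.Holds J := by
  intro τ hτ
  have h0 := hτ _ (List.mem_singleton_self _)
  rw [Lit.atom_sat_iff] at h0
  have h1 := h.input _ rfl h0
  simp only [Lit.map, Prod.mk.injEq] at h1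
  refine ⟨Function.update τ 2 (ν y), fun a ha x hx => ?_, fun a ha => ?_⟩
  · obtain rfl := List.mem_singleton.1 ha
    simp only [Lit.mem_vars_atom, Lit.args] at hx
    rw [Function.update_of_ne (by rintro rfl; simp at hx)]
  · obtain rfl := List.mem_singleton.1 ha
    rw [Lit.atom_sat_iff]
    simpa [Lit.map, h1, h.map_code, h.map_arg] using hy

theorem ready_of_dom {u : Code} {n : ℕ} (h : (u.eval n).Dom) : (readinessInput u n).Ready := by
  obtain ⟨y, hy⟩ := Part.dom_iff_mem.1 h
  have hmem : ∀ l ∈ codeLits u, Forced u n l := fun l hl =>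
    forced_of_mem_baseLits (List.mem_append_right _ (List.mem_append_right _ hl))
  obtain ⟨N, Qs, hQs, hN⟩ := (forced_closedUnderRules u n).eval_of_mem_eval
    (forced_of_mem_baseLits (by simp [baseLits])) (forced_succ u n)
    (forced_of_mem_baseLits (by simp [baseLits])) hmem hy
  -- `Ps` builds the chain that the derivation needs; `Qs` then carries out the derivation in it.
  obtain ⟨Ps, hPs, hout⟩ := exists_interprets u n N
  refine ⟨Ps ++ Qs, List.forall_mem_append.2 ⟨hPs, hQs⟩, fun K hK c hc => ?_⟩
  obtain rfl := List.mem_singleton.1 hc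
  refine ⟨targetTgd_compatible, ?_⟩
  obtain ⟨J, hJ, hK⟩ := (seqOutcomes_append _ _ _ _).1 hK
  obtain ⟨ν, hν⟩ := hout J hJ
  exact (hν.preserved hQs hK).1.targetTgd_holds
    (hN ν J (hν.anti (Nat.le_add_left _ _)) K hK _ (List.mem_singleton_self _))

/-! ### Computability of the reduction -/

theorem primrec_fact {f g h : ℕ → ℕ} (k b : ℕ) (hf : Primrec f) (hg : Primrec g) (hh : Primrec h) :
    Primrec fun n => Lit.fact b (k, f n, g n, h n) := by
  have key : Primrec fun n => (2 * k + b, [(0, f n), (1, g n), (2, h n)]) :=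
    (Primrec.const _).pair (Primrec.list_cons.comp ((Primrec.const 0).pair hf)
      (Primrec.list_cons.comp ((Primrec.const 1).pair hg)
        (Primrec.list_cons.comp ((Primrec.const 2).pair hh) (Primrec.const []))))
  exact (Primrec.of_equiv_symm (e := Fact.equiv)).comp key

/-- As `u` is fixed, only the input facts and the length of the chain vary with `n`. -/
theorem primrec_readinessInput (u : Code) : Primrec (readinessInput u) := by
  have hrange : Primrec fun n => (List.range (n + (encode u + baseBound u))).map
      fun i => Lit.fact 0 (.succ i (i + 1)) :=
    Primrec.list_map
      (Primrec.list_range.comp (Primrec.nat_add.comp Primrec.id (Primrec.const _)))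
      ((primrec_fact 1 0 Primrec.id Primrec.succ Primrec.succ).comp Primrec.snd).to₂
  have hinput : ∀ b, Primrec fun n => Lit.fact b (.input (encode u) n) := fun b =>
    primrec_fact 5 b (Primrec.const _) Primrec.id Primrec.id
  have hfacts : Primrec (inputFacts u) :=
    Primrec.list_append.comp (Primrec.list_append.comp
      (Primrec.const ((baseLits u).flatMap fun l => [l.fact 0, l.fact 1]))
      (Primrec.list_cons.comp (hinput 0)
        (Primrec.list_cons.comp (hinput 1) (Primrec.const [])))) hrange
  have key : Primrec fun n =>
      (ternSchema, inputFacts u n, readinessProcs, [Dependency.tgd targetTgd]) :=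
    (Primrec.const _).pair (hfacts.pair (Primrec.const _))
  exact (Primrec.of_equiv_symm (e := ReadinessInput.equiv)).comp key

/-- There is a program for which halting at a given argument is undecidable. -/
theorem exists_code_undecidable_halting : ∃ u : Code, u ≠ .zero ∧
    ¬ ∃ g : ℕ → Bool, Computable g ∧ ∀ n, g n = true ↔ (u.eval n).Dom := by
  have hpart : Nat.Partrec fun n => (Denumerable.ofNat Code n).eval 0 :=
    Partrec.nat_iff.1
      (Code.eval_part.comp (Computable.ofNat Code) (Computable.const 0))
  obtain ⟨u, hu⟩ := Code.exists_code.1 hpart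
  -- Here `u` runs the program coded by its argument at 0. Composing with the total `succ` leaves
  -- halting unchanged and makes the program visibly different from `Code.zero`.
  have hdom : ∀ c : Code, ((Code.comp .succ u).eval (encode c)).Dom ↔ (c.eval 0).Dom := by
    intro c
    have : u.eval (encode c) = c.eval 0 := by
      rw [hu]
      exact congrArg (fun c : Code => c.eval 0) (Denumerable.ofNat_encode c)
    rw [← this, Part.dom_iff_mem, Part.dom_iff_mem]
    constructor
    · rintro ⟨y, hy⟩
      obtain ⟨a, ha, -⟩ := mem_eval_comp_iff.1 hy
      exact ⟨a, ha⟩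
    · rintro ⟨a, ha⟩
      exact ⟨a + 1, mem_eval_comp_iff.2 ⟨a, ha, by simp [Code.eval]⟩⟩
  refine ⟨.comp .succ u, by simp, ?_⟩
  rintro ⟨g, hg, h⟩
  refine ComputablePred.halting_problem 0 (ComputablePred.computable_iff.2
    ⟨fun c => g (encode c), hg.comp Computable.encode, ?_⟩)
  funext c
  exact propext ((hdom c).symm.trans (h (encode c)).symm)

end DataReadiness

open DataReadiness in
/-- Constraint readiness is undecidable even for inputs whose procedures all have safe scope and
whose target is a single acyclic tgd (moreover all of them compatible with the schema, and the
target not yet true in the given instance): no computable function answers all these inputs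
correctly, whatever it does on other inputs. -/
theorem mainTheorem6 :
    ¬ ∃ f : ReadinessInput → Bool, Computable f ∧
      ∀ x : ReadinessInput,
        (∀ P ∈ x.procs, P.SafeScope ∧ P.Compatible x.schema) →
        (∃ t : Tgd, x.target = [Dependency.tgd t] ∧ t.Acyclic ∧
          (Dependency.tgd t).Compatible x.schema ∧ ¬ (Dependency.tgd t).Holds x.inst) →
        (f x = true ↔ x.Ready) := by
  rintro ⟨f, hf, h⟩
  obtain ⟨u, hu, hundec⟩ := exists_code_undecidable_halting
  refine hundec ⟨fun n => f (readinessInput u n), hf.comp (primrec_readinessInput u).to_comp,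
    fun n => ?_⟩
  rw [h (readinessInput u n)]
  · exact ⟨dom_of_ready, ready_of_dom⟩
  · intro P hP
    obtain ⟨d, hd, rfl⟩ := List.mem_map.1 hP
    exact ⟨tgdProcedure_safeScope (readinessTgds_acyclic d hd),
      tgdProcedure_compatible (readinessTgds_compatible d hd)⟩
  · exact ⟨targetTgd, rfl, targetTgd_acyclic, targetTgd_compatible, fun ht =>
      targetTgd_not_holds hu n ht.2⟩
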